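/- Let $X$ be a measurable space, $Y\subseteq\mathbb{R}$, and let $\rho$ be a probability measure on $X\times Y$. Let $\mathcal{F}$ be a real separable Hilbert space, $\Phi:X\to\mathcal{F}$ a measurable map, and $V:\mathbb{R}\times\mathbb{R}\to[0,\infty)$ a measurable loss function. For $w\in\mathcal{F}$ put $\mathcal{E}(w)=\int_{X\times Y}V(y,\langle w,\Phi(x)\rangle)\,d\rho(x,y)$. Assume: (1) $\kappa=\sup_{x\in X}\sqrt{\langle\Phi(x),\Phi(x)\rangle}<\infty$; for every $y\in Y$ the function $V(y,\cdot)$ is convex and its left-hand derivative satisfies $|V'_-(y,a)|\le a_0$ for all $a\in\mathbb{R}$; and $\sup_{y\in Y}V(y,0)<\infty$. (2) For some $\beta\in(0,1]$ and $c_\beta>0$, for all $\lambda>0$, $$\inf_{w\in\mathcal{F}}\Big\{\mathcal{E}(w)+\frac{\lambda}{2}\|w\|^2\Big\}-\inf_{w\in\mathcal{F}}\mathcal{E}(w)\le c_\beta\lambda^\beta .$$ (3) For every $y\in Y$ the function $V(y,\cdot)$ is differentiable and its derivative is Lipschitz continuous with constant $L>0$. Let $m\ge 1$, let $\mathbf{z}=((x_i,y_i))_{i=1}^m$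 be drawn i.i.d. from $\rho$, and, given $\mathbf{z}$, let $j_1,j_2,\dots$ be i.i.d. uniform on $\{1,\dots,m\}$. Let $\eta_t=\eta_1/\sqrt{t}$ for $t\ge1$, with a constant $0<\eta_1\le 2/(\kappa^2L)$, and define the stochastic gradient iterates by $w_1=0$ and $$w_{t+1}=w_t-\eta_tV'_-(y_{j_t},\langle w_t,\Phi(x_{j_t})\rangle)\,\Phi(x_{j_t}),$$ and the averaged iterates by $\overline{w}_t=\sum_{k=1}^t\eta_kw_k\big/\sum_{k=1}^t\eta_k$. Let $\mathbb{E}$ denote the expectation over the indices $j_1,\dots,j_t$ given $\mathbf{z}$ first, and then over $\mathbf{z}$. Then there is a constant $C>0$, depending only on $\kappa,a_0,\beta,c_\beta,\eta_1$ (and not on $m$ or $t$), such that for all $m\ge1$ and all $t\ge 1$, for $g_t=\overline{w}_t$ as well as for $g_t=w_t$, the expected excess risk is well defined and $$\mathbb{E}\big[\mathcal{E}(g_t)-\inf_{w\in\mathcal{F}}\mathcal{E}(w)\big]\le C\left(\frac{\sqrt{t}\,\log t}{m}+\frac{\log t}{\sqrt{t}}+\frac{1}{t^{\beta/2}}\right).$$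 In particular, for all $m\ge2$ and $t^*=\lceil m^{2/(\beta+1)}\rceil$ (the smallest integer not less than $m^{2/(\beta+1)}$), $$\mathbb{E}\big[\mathcal{E}(g_{t^*})-\inf_{w\in\mathcal{F}}\mathcal{E}(w)\big]\le C\,m^{-\frac{\beta}{\beta+1}}\log m .$$ -/

import Mathlib

namespace SGM

section

variable {X : Type*} [MeasurableSpace X] {Y : Set ℝ}
  {F : Type*} [NormedAddCommGroup F] [InnerProductSpace ℝ F]

/-- The left-hand derivative of `V y` at `a`. -/
noncomputable def leftDeriv (V : ℝ → ℝ → ℝ) (y a : ℝ) : ℝ :=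
  derivWithin (V y) (Set.Iio a) a

/-- The linear function `x ↦ ⟨w, Φ x⟩` parametrized by `w`. -/
def linFun (Φ : X → F) (w : F) (x : X) : ℝ := inner ℝ w (Φ x)

/-- The expected risk `∫ V(y, f(x)) dρ` of a function `f`. -/
noncomputable def expectedRisk (ρ : MeasureTheory.Measure (X × Y)) (V : ℝ → ℝ → ℝ)
    (f : X → ℝ) : ℝ :=
  ∫ z, V z.2 (f z.1) ∂ρ

/-- The expected risk of the function `x ↦ ⟨w, Φ x⟩`. -/
noncomputable def risk (ρ : MeasureTheory.Measure (X × Y)) (V : ℝ → ℝ → ℝ) (Φ : X → F)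
    (w : F) : ℝ :=
  expectedRisk ρ V (linFun Φ w)

/-- The excess risk of `w` over the infimum of the risk on the whole space. -/
noncomputable def excessRisk (ρ : MeasureTheory.Measure (X × Y)) (V : ℝ → ℝ → ℝ) (Φ : X → F)
    (w : F) : ℝ :=
  risk ρ V Φ w - ⨅ v : F, risk ρ V Φ v

/-- The approximation error of the triplet `(ρ, V, Φ)` at level `lam`. -/
noncomputable def approxError (ρ : MeasureTheory.Measure (X × Y)) (V : ℝ → ℝ → ℝ) (Φ : X → F)
    (lam : ℝ) : ℝ :=
  (⨅ w : F, (risk ρ V Φ w + lam / 2 * ‖w‖ ^ 2)) - ⨅ w : F, risk ρ V Φ w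

/-- Bounded features with `κ = sup √⟨Φ x, Φ x⟩`, and a loss which is convex in its second entry,
satisfies `sup_{y ∈ Y} V(y, 0) < ∞` and has a left-hand derivative bounded by `a₀`. -/
structure BoundedAssumption (Y : Set ℝ) (V : ℝ → ℝ → ℝ) (Φ : X → F) (κ a₀ : ℝ) : Prop where
  isLUB_kernel : IsLUB (Set.range fun x => √(inner ℝ (Φ x) (Φ x))) κ
  convex : ∀ y ∈ Y, ConvexOn ℝ Set.univ (V y)
  bddAbove_zero : BddAbove ((fun y => V y 0) '' Y)
  leftDeriv_le : ∀ y ∈ Y, ∀ a : ℝ, |leftDeriv V y a| ≤ a₀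

/-- Polynomial decay of the approximation error. -/
def ApproxAssumption (ρ : MeasureTheory.Measure (X × Y)) (V : ℝ → ℝ → ℝ) (Φ : X → F)
    (β cβ : ℝ) : Prop :=
  ∀ lam : ℝ, 0 < lam → approxError ρ V Φ lam ≤ cβ * lam ^ β

/-- The loss is differentiable in its second entry, with `L`-Lipschitz derivative. -/
def SmoothAssumption (Y : Set ℝ) (V : ℝ → ℝ → ℝ) (L : ℝ) : Prop :=
  ∀ y ∈ Y, Differentiable ℝ (V y) ∧
    ∀ a b : ℝ, |deriv (V y) b - deriv (V y) a| ≤ L * |b - a|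

/-- The iterates of the stochastic gradient method on the sample `z`, run with the indices
`J = (j_1, …, j_T)`:  `w_1 = 0` and `w_{k+1} = w_k - η_k V'_-(y_{j_k}, ⟨w_k, Φ(x_{j_k})⟩) Φ(x_{j_k})`
for `k = 1, …, T`. (The values at index `0` and at indices above `T + 1` play no role.) -/
noncomputable def iterate (V : ℝ → ℝ → ℝ) (Φ : X → F) (η : ℕ → ℝ) {m T : ℕ}
    (z : Fin m → X × Y) (J : Finset.Icc 1 T → Fin m) : ℕ → F
  | 0 => 0
  | k + 1 =>
    if h : k ∈ Finset.Icc 1 T then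
      iterate V Φ η z J k -
        (η k * leftDeriv V (z (J ⟨k, h⟩)).2
          (inner ℝ (iterate V Φ η z J k) (Φ (z (J ⟨k, h⟩)).1))) • Φ (z (J ⟨k, h⟩)).1
    else iterate V Φ η z J k

/-- The weighted averages `(∑_{k=1}^t η_k w_k) / (∑_{k=1}^t η_k)` of the iterates. -/
noncomputable def averagedIterate (V : ℝ → ℝ → ℝ) (Φ : X → F) (η : ℕ → ℝ) {m T : ℕ}
    (z : Fin m → X × Y) (J : Finset.Icc 1 T → Fin m) (t : ℕ) : F :=
  (∑ k ∈ Finset.Icc 1 t, η k)⁻¹ • ∑ k ∈ Finset.Icc 1 t, η k • iterate V Φ η z J k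

/-- The law of `J = (j_1, …, j_T)`: i.i.d. uniform on the `m` indices of the sample. -/
noncomputable def indexLaw (m T : ℕ) : MeasureTheory.Measure (Finset.Icc 1 T → Fin m) :=
  MeasureTheory.Measure.pi fun _ => ProbabilityTheory.uniformOn (Set.univ : Set (Fin m))

/-- The law of the sample: `m` independent draws from `ρ`. -/
noncomputable def sampleLaw (ρ : MeasureTheory.Measure (X × Y)) (m : ℕ) :
    MeasureTheory.Measure (Fin m → X × Y) :=
  MeasureTheory.Measure.pi fun _ => ρ

/-- The expectation over `J`, given the sample `z`, of the excess risk of the output `g z J`. -/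
noncomputable def condExcessRisk (ρ : MeasureTheory.Measure (X × Y)) (V : ℝ → ℝ → ℝ)
    (Φ : X → F) {m T : ℕ} (g : (Fin m → X × Y) → (Finset.Icc 1 T → Fin m) → F)
    (z : Fin m → X × Y) : ℝ :=
  ∫ J, excessRisk ρ V Φ (g z J) ∂(indexLaw m T)

/-- The expected excess risk of the output `g`: expectation over `J` first, then over the
sample. -/
noncomputable def meanExcessRisk (ρ : MeasureTheory.Measure (X × Y)) (V : ℝ → ℝ → ℝ)
    (Φ : X → F) {m T : ℕ} (g : (Fin m → X × Y) → (Finset.Icc 1 T → Fin m) → F) : ℝ :=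
  ∫ z, condExcessRisk ρ V Φ g z ∂(sampleLaw ρ m)

/-- The output `g` is the averaged or the last iterate after `t` steps, the method being run with
step-sizes `η` and indices `j_1, …, j_t`. -/
def IsOutput (V : ℝ → ℝ → ℝ) (Φ : X → F) (η : ℕ → ℝ) {m : ℕ} (t : ℕ)
    (g : (Fin m → X × Y) → (Finset.Icc 1 t → Fin m) → F) : Prop :=
  (g = fun z J => averagedIterate V Φ η z J t) ∨ (g = fun z J => iterate V Φ η z J t)

end

end SGM

/-! Against a fixed comparator `w`, the expected excess risk splits into a generalization gap, an
optimization error on the sample, and the excess risk of `w`.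

Optimization (`expect_empRisk_le`): the usual expansion of `‖w_{k+1} - v‖²`, averaged over the
indices, bounds weighted sums of excess empirical risk. Convexity turns this into a bound for the
averaged iterate. For the last iterate the comparators `v = w_r` are used as well: they control
every suffix average, and `last_le_of_suffix` passes from the full average to the last term at the
price of a logarithm.

Generalization (`integral_risk_sub_le`): smoothness and `η_k κ² L ≤ 2` make each step nonexpansive,
so replacing one observation matters only when it is drawn. Summed over the replaced observation,
the outputs move by at most `2 a₀ κ ∑ η_l`, of order `√t`; exchangeability then gives a gap of order
`√t / m`.

Approximation (`meanExcessRisk_le`): the optimization error contains `(λ/2)‖w‖²` with `λ =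
1/(η₁√t)`, so the infimum over `w` is the regularized risk and the approximation hypothesis yields
`t^{-β/2}`. Taking `t` near `m^{2/(β+1)}` balances `√t / m` with `t^{-β/2}`. -/

namespace SGM

open MeasureTheory
open scoped BigOperators

/-! ### From weighted averages to the last term, with step sizes `η₁/√k` -/

/-- One step of the recursion on weighted suffix averages. -/
theorem suffix_average_step {P P' H H' Q Q' a e B : ℝ} (hH' : 0 < H') (ha : 0 < a)
    (hP : P = a * e + P') (hH : H = a + H') (hQ : Q = a ^ 2 + Q')
    (h : P - e * H ≤ B * Q) :
    (P' - B * Q') / H' ≤ (P - B * Q) / H + B * (a ^ 2 / H') := by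
  have hHpos : 0 < H := by linarith
  -- By `h`, the entry `e` is at least the corrected average `(P - B * Q) / H`; deleting an entry
  -- above the average can only lower it.
  have key : (P' - B * Q') / H' - B * (a ^ 2 / H') ≤ (P - B * Q) / H := by
    have : (P' - B * Q') / H' - B * (a ^ 2 / H') = (P - B * Q - a * e) / H' := by
      rw [hP, hQ]; field_simp; ring
    rw [this, div_le_div_iff₀ hH' hHpos]
    have h2 : a * (P - B * Q) ≤ a * (e * H) := mul_le_mul_of_nonneg_left (by linarith) ha.le
    have h3 : H' = H - a := by linarith
    rw [h3]; nlinarith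
  linarith

/-- If every weighted suffix average of `e` is at most its first term plus a multiple of the
squared weights, then the last term is controlled by the full weighted average. -/
theorem last_le_of_suffix {η e : ℕ → ℝ} {t : ℕ} {B : ℝ} (ht : 1 ≤ t) (hη : ∀ i, 1 ≤ i → 0 < η i)
    (h : ∀ r, 1 ≤ r → r ≤ t →
      ∑ i ∈ Finset.Ico r (t + 1), η i * (e i - e r) ≤ B * ∑ i ∈ Finset.Ico r (t + 1), η i ^ 2) :
    e t ≤ B * η t + (∑ i ∈ Finset.Ico 1 (t + 1), η i * e i
        - B * ∑ i ∈ Finset.Ico 1 (t + 1), η i ^ 2) / ∑ i ∈ Finset.Ico 1 (t + 1), η i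
      + B * ∑ r ∈ Finset.Ico 1 t, η r ^ 2 / ∑ i ∈ Finset.Ico (r + 1) (t + 1), η i := by
  -- Delete the terms one at a time from the left; at `s = t` only the last term remains.
  have main : ∀ s, 1 ≤ s → s ≤ t →
      (∑ i ∈ Finset.Ico s (t + 1), η i * e i
        - B * ∑ i ∈ Finset.Ico s (t + 1), η i ^ 2) / ∑ i ∈ Finset.Ico s (t + 1), η i ≤
      (∑ i ∈ Finset.Ico 1 (t + 1), η i * e i
        - B * ∑ i ∈ Finset.Ico 1 (t + 1), η i ^ 2) / ∑ i ∈ Finset.Ico 1 (t + 1), η i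
      + B * ∑ r ∈ Finset.Ico 1 s, η r ^ 2 / ∑ i ∈ Finset.Ico (r + 1) (t + 1), η i := by
    intro s hs
    induction s, hs using Nat.le_induction with
    | base => intro _; simp
    | succ s hs ih =>
      intro hst
      have ih := ih (by omega)
      rw [Finset.sum_Ico_succ_top hs]
      have hlt : s < t + 1 := by omega
      have hpos : 0 < ∑ i ∈ Finset.Ico (s + 1) (t + 1), η i := by
        apply Finset.sum_pos
        · intro i hi; rw [Finset.mem_Ico] at hi; exact hη i (by omega)
        · exact ⟨t, by simp; omega⟩
      have hr := h s hs (by omega)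
      simp only [mul_sub, Finset.sum_sub_distrib] at hr
      rw [← Finset.sum_mul] at hr
      have := suffix_average_step (B := B) (e := e s) hpos (hη s hs)
        (Finset.sum_eq_sum_Ico_succ_bot hlt (fun i => η i * e i))
        (Finset.sum_eq_sum_Ico_succ_bot hlt η)
        (Finset.sum_eq_sum_Ico_succ_bot hlt (fun i => η i ^ 2)) (by linarith)
      linarith
  have h1 := main t ht le_rfl
  have h0 := hη t ht
  simp only [Nat.Ico_succ_singleton, Finset.sum_singleton] at h1
  have : (η t * e t - B * η t ^ 2) / η t = e t - B * η t := by field_simp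
  rw [this] at h1
  linarith

theorem sum_Ico_inv_le (t : ℕ) :
    ∑ i ∈ Finset.Ico 1 (t + 1), ((i : ℝ))⁻¹ ≤ 1 + Real.log t := by
  have := harmonic_le_one_add_log t
  rw [harmonic_eq_sum_Icc] at this
  push_cast at this
  exact this

theorem div_sqrt_sq (η₁ : ℝ) (r : ℕ) : (η₁ / √(r : ℝ)) ^ 2 = η₁ ^ 2 * (r : ℝ)⁻¹ := by
  rw [div_pow, Real.sq_sqrt (Nat.cast_nonneg r), div_eq_mul_inv]

theorem stepSize_pos {η₁ : ℝ} (hη₁ : 0 < η₁) {i : ℕ} (hi : 1 ≤ i) : 0 < η₁ / √(i : ℝ) := by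
  have : (0 : ℝ) < i := by exact_mod_cast hi
  positivity

theorem sum_sq_stepSize_le (η₁ : ℝ) (t : ℕ) :
    ∑ i ∈ Finset.Ico 1 (t + 1), (η₁ / √(i : ℝ)) ^ 2 ≤ η₁ ^ 2 * (1 + Real.log t) := by
  simp only [div_sqrt_sq, ← Finset.mul_sum]
  exact mul_le_mul_of_nonneg_left (sum_Ico_inv_le t) (sq_nonneg _)

theorem le_sum_stepSize {η₁ : ℝ} (hη₁ : 0 < η₁) {r t : ℕ} (hr : r ≤ t) :
    ((t : ℝ) - r) * (η₁ / √(t : ℝ)) ≤ ∑ i ∈ Finset.Ico (r + 1) (t + 1), η₁ / √(i : ℝ) := by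
  have : ∑ i ∈ Finset.Ico (r + 1) (t + 1), η₁ / √(t : ℝ) = ((t : ℝ) - r) * (η₁ / √(t : ℝ)) := by
    rw [Finset.sum_const, Nat.card_Ico, nsmul_eq_mul, Nat.add_sub_add_right, Nat.cast_sub hr]
  rw [← this]
  apply Finset.sum_le_sum
  intro i hi
  rw [Finset.mem_Ico] at hi
  have h1 : (0 : ℝ) < i := by exact_mod_cast (by omega : 0 < i)
  have h2 : (i : ℝ) ≤ t := by exact_mod_cast (by omega : i ≤ t)
  have := Real.sqrt_pos.2 h1
  have := Real.sqrt_le_sqrt h2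
  gcongr

theorem mul_sqrt_le_sum_stepSize {η₁ : ℝ} (hη₁ : 0 < η₁) (t : ℕ) :
    η₁ * √(t : ℝ) ≤ ∑ i ∈ Finset.Ico 1 (t + 1), η₁ / √(i : ℝ) := by
  have := le_sum_stepSize hη₁ (Nat.zero_le t)
  simp only [Nat.cast_zero, sub_zero, zero_add] at this
  refine le_trans (le_of_eq ?_) this
  rw [mul_div_left_comm, Real.div_sqrt]

/-- The suffix sum is at least `(t - r) η₁/√t`, and `t / (r (t - r)) = 1/r + 1/(t - r)` leaves two
harmonic sums, equal after reflection. -/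
theorem sum_sq_div_suffix_le {η₁ : ℝ} (hη₁ : 0 < η₁) {t : ℕ} (ht : 1 ≤ t) :
    ∑ r ∈ Finset.Ico 1 t, (η₁ / √(r : ℝ)) ^ 2 / ∑ i ∈ Finset.Ico (r + 1) (t + 1), η₁ / √(i : ℝ)
      ≤ 2 * η₁ * (1 + Real.log t) / √(t : ℝ) := by
  have ht0 : (0 : ℝ) < t := by exact_mod_cast ht
  have hs := Real.sqrt_pos.2 ht0
  have step : ∀ r ∈ Finset.Ico 1 t,
      (η₁ / √(r : ℝ)) ^ 2 / ∑ i ∈ Finset.Ico (r + 1) (t + 1), η₁ / √(i : ℝ) ≤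
        η₁ / √(t : ℝ) * ((r : ℝ)⁻¹ + (((t - r : ℕ)) : ℝ)⁻¹) := by
    intro r hr
    rw [Finset.mem_Ico] at hr
    have h1 : (0 : ℝ) < r := by exact_mod_cast hr.1
    have h2 : (0 : ℝ) < (t : ℝ) - r := sub_pos.2 (by exact_mod_cast hr.2)
    rw [Nat.cast_sub hr.2.le, div_sqrt_sq]
    calc _ ≤ η₁ ^ 2 * (r : ℝ)⁻¹ / (((t : ℝ) - r) * (η₁ / √(t : ℝ))) := by
          apply div_le_div_of_nonneg_left (by positivity) (by positivity)
            (le_sum_stepSize hη₁ hr.2.le)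
      _ = _ := by
          field_simp
          rw [Real.sq_sqrt ht0.le]; ring
  refine (Finset.sum_le_sum step).trans ?_
  rw [← Finset.mul_sum, Finset.sum_add_distrib]
  have hrefl : ∑ r ∈ Finset.Ico 1 t, (((t - r : ℕ)) : ℝ)⁻¹ = ∑ r ∈ Finset.Ico 1 t, ((r : ℝ))⁻¹ := by
    have := Finset.sum_Ico_reflect (fun r : ℕ => ((r : ℝ))⁻¹) 1 (m := t) (n := t) (by omega)
    simpa using this
  have hle : ∑ r ∈ Finset.Ico 1 t, ((r : ℝ))⁻¹ ≤ 1 + Real.log t := by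
    refine le_trans ?_ (sum_Ico_inv_le t)
    rw [Finset.sum_Ico_succ_top ht]
    have : (0 : ℝ) ≤ (t : ℝ)⁻¹ := by positivity
    linarith
  rw [hrefl, div_mul_eq_mul_div]
  apply div_le_div_of_nonneg_right _ hs.le
  nlinarith

/-- The factor 3 is what `last_le` needs; it is kept here so that both outputs obey the same bound.
-/
theorem average_le {η₁ : ℝ} (hη₁ : 0 < η₁) {e : ℕ → ℝ} {t : ℕ} (ht : 1 ≤ t) {B R N : ℝ}
    (hB : 0 ≤ B) (hN : 0 ≤ N)
    (h : ∑ i ∈ Finset.Ico 1 (t + 1), η₁ / √(i : ℝ) * (e i - R) ≤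
      N / 2 + B * ∑ i ∈ Finset.Ico 1 (t + 1), (η₁ / √(i : ℝ)) ^ 2) :
    (∑ i ∈ Finset.Ico 1 (t + 1), η₁ / √(i : ℝ) * e i) / ∑ i ∈ Finset.Ico 1 (t + 1), η₁ / √(i : ℝ)
      ≤ R + (1 / (η₁ * √(t : ℝ))) / 2 * N + 3 * B * η₁ * ((1 + Real.log t) / √(t : ℝ)) := by
  have ht0 : (0 : ℝ) < t := by exact_mod_cast ht
  have hs := Real.sqrt_pos.2 ht0
  have hl : 0 ≤ Real.log t := Real.log_nonneg (by exact_mod_cast ht)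
  have hH := mul_sqrt_le_sum_stepSize hη₁ t
  have hQ := sum_sq_stepSize_le η₁ t
  set H := ∑ i ∈ Finset.Ico 1 (t + 1), η₁ / √(i : ℝ)
  set Q := ∑ i ∈ Finset.Ico 1 (t + 1), (η₁ / √(i : ℝ)) ^ 2
  have hHpos : 0 < H := lt_of_lt_of_le (by positivity) hH
  simp only [mul_sub, Finset.sum_sub_distrib] at h
  rw [← Finset.sum_mul] at h
  set A := (1 / (η₁ * √(t : ℝ))) / 2 * N + 3 * B * η₁ * ((1 + Real.log t) / √(t : ℝ)) with hA
  have hA0 : 0 ≤ A := by positivity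
  rw [add_assoc, ← hA, div_le_iff₀ hHpos]
  have hAH : N / 2 + B * Q ≤ A * (η₁ * √(t : ℝ)) := by
    have : A * (η₁ * √(t : ℝ)) = N / 2 + 3 * B * (η₁ ^ 2 * (1 + Real.log t)) := by
      rw [hA]; field_simp
    rw [this]
    have := mul_le_mul_of_nonneg_left hQ hB
    have : 0 ≤ B * (η₁ ^ 2 * (1 + Real.log t)) := by positivity
    linarith
  have := mul_le_mul_of_nonneg_left hH hA0
  linarith

/-- The term `-B ∑ η²` of `last_le_of_suffix` cancels the one in `h`. The factor 3 is 1 from the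
last step plus 2 from the suffix sums. -/
theorem last_le {η₁ : ℝ} (hη₁ : 0 < η₁) {e : ℕ → ℝ} {t : ℕ} (ht : 1 ≤ t) {B R N : ℝ}
    (hB : 0 ≤ B) (hN : 0 ≤ N)
    (h : ∑ i ∈ Finset.Ico 1 (t + 1), η₁ / √(i : ℝ) * (e i - R) ≤
      N / 2 + B * ∑ i ∈ Finset.Ico 1 (t + 1), (η₁ / √(i : ℝ)) ^ 2)
    (h' : ∀ r, 1 ≤ r → r ≤ t → ∑ i ∈ Finset.Ico r (t + 1), η₁ / √(i : ℝ) * (e i - e r) ≤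
      B * ∑ i ∈ Finset.Ico r (t + 1), (η₁ / √(i : ℝ)) ^ 2) :
    e t ≤ R + (1 / (η₁ * √(t : ℝ))) / 2 * N + 3 * B * η₁ * ((1 + Real.log t) / √(t : ℝ)) := by
  have ht0 : (0 : ℝ) < t := by exact_mod_cast ht
  have hs := Real.sqrt_pos.2 ht0
  have hl : 0 ≤ Real.log t := Real.log_nonneg (by exact_mod_cast ht)
  have hH := mul_sqrt_le_sum_stepSize hη₁ t
  have hlast := last_le_of_suffix (η := fun i => η₁ / √(i : ℝ)) ht
    (fun i hi => stepSize_pos hη₁ hi) h'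
  have hsum := mul_le_mul_of_nonneg_left (sum_sq_div_suffix_le hη₁ ht) hB
  beta_reduce at hlast
  set H := ∑ i ∈ Finset.Ico 1 (t + 1), η₁ / √(i : ℝ)
  set Q := ∑ i ∈ Finset.Ico 1 (t + 1), (η₁ / √(i : ℝ)) ^ 2
  have hHpos : 0 < H := lt_of_lt_of_le (by positivity) hH
  simp only [mul_sub, Finset.sum_sub_distrib] at h
  rw [← Finset.sum_mul] at h
  have h1 : (∑ i ∈ Finset.Ico 1 (t + 1), η₁ / √(i : ℝ) * e i - B * Q) / H ≤
      R + (1 / (η₁ * √(t : ℝ))) / 2 * N := by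
    rw [div_le_iff₀ hHpos]
    have : N / 2 = (1 / (η₁ * √(t : ℝ))) / 2 * N * (η₁ * √(t : ℝ)) := by field_simp
    have h2 := mul_le_mul_of_nonneg_left hH
      (by positivity : 0 ≤ (1 / (η₁ * √(t : ℝ))) / 2 * N)
    linarith
  have h3 : B * (η₁ / √(t : ℝ)) ≤ B * η₁ * ((1 + Real.log t) / √(t : ℝ)) := by
    rw [mul_assoc]
    apply mul_le_mul_of_nonneg_left _ hB
    rw [← mul_div_assoc]
    apply div_le_div_of_nonneg_right _ hs.le
    nlinarith
  have h4 : B * (2 * η₁ * (1 + Real.log t) / √(t : ℝ)) =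
      2 * B * η₁ * ((1 + Real.log t) / √(t : ℝ)) := by ring
  linarith

/-! ### Exchangeability and generalization by on-average stability -/

/-- Exchanging the `i`-th point of an i.i.d. sample with an independent copy preserves the joint
law. -/
theorem measurePreserving_update {Z : Type*} [MeasurableSpace Z] (ρ : Measure Z)
    [IsProbabilityMeasure ρ] {m : ℕ} (i : Fin m) :
    MeasurePreserving (fun p : (Fin m → Z) × Z => (Function.update p.1 i p.2, p.1 i))
      ((Measure.pi fun _ => ρ).prod ρ) ((Measure.pi fun _ => ρ).prod ρ) := by
  have hmeas : Measurable
      (fun p : (Fin m → Z) × Z => ((Function.update p.1 i p.2, p.1 i) : (Fin m → Z) × Z)) := by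
    refine Measurable.prodMk ?_ ((measurable_pi_apply i).comp measurable_fst)
    rw [measurable_pi_iff]
    intro a
    by_cases h : a = i
    · subst h; simpa using measurable_snd
    · simp only [Function.update_of_ne h]
      exact (measurable_pi_apply a).comp measurable_fst
  refine ⟨hmeas, (Measure.prod_eq_generateFrom generateFrom_pi
    MeasurableSpace.generateFrom_measurableSet isPiSystem_pi MeasurableSpace.isPiSystem_measurableSet
    ⟨fun _ => Set.univ, fun _ => ⟨fun _ => Set.univ, by simp, by simp⟩, by simp,
      Set.iUnion_const _⟩ ρ.toFiniteSpanningSetsIn ?_).symm⟩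
  rintro _ ⟨s, hs, rfl⟩ t ht
  have hs' : ∀ j, MeasurableSet (s j) := fun j => hs j (Set.mem_univ j)
  rw [Measure.map_apply hmeas ((MeasurableSet.univ_pi hs').prod ht)]
  -- On boxes the exchange trades the side `s i` for `t`, which leaves the product of masses
  -- unchanged.
  have : (fun p : (Fin m → Z) × Z => (Function.update p.1 i p.2, p.1 i)) ⁻¹' (Set.univ.pi s ×ˢ t)
      = (Set.univ.pi (Function.update s i t)) ×ˢ (s i) := by
    ext ⟨z, x⟩
    simp only [Set.mem_preimage, Set.mem_prod, Set.mem_univ_pi]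
    constructor
    · rintro ⟨h1, h2⟩
      refine ⟨fun j => ?_, by simpa using h1 i⟩
      by_cases hj : j = i
      · subst hj; simpa using h2
      · simpa [hj] using h1 j
    · rintro ⟨h1, h2⟩
      refine ⟨fun j => ?_, by simpa using h1 i⟩
      by_cases hj : j = i
      · subst hj; simpa using h2
      · simpa [hj] using h1 j
  rw [this, Measure.prod_prod, Measure.pi_pi, Measure.pi_pi,
    ← Finset.mul_prod_erase Finset.univ _ (Finset.mem_univ i),
    ← Finset.mul_prod_erase Finset.univ (fun j => ρ (s j)) (Finset.mem_univ i)]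
  have hprod : ∏ j ∈ Finset.univ.erase i, ρ (Function.update s i t j) =
      ∏ j ∈ Finset.univ.erase i, ρ (s j) :=
    Finset.prod_congr rfl fun j hj => by rw [Function.update_of_ne (Finset.ne_of_mem_erase hj)]
  rw [hprod, Function.update_self]
  ring

/-- On-average stability bounds the expected generalization gap of a Lipschitz loss. -/
theorem integral_risk_sub_le {Z F : Type*} [MeasurableSpace Z] [NormedAddCommGroup F]
    [MeasurableSpace F] (ρ : Measure Z) [IsProbabilityMeasure ρ] {m : ℕ} (hm : 1 ≤ m)
    {ℓ : Z → F → ℝ} (hℓ : Measurable fun p : Z × F => ℓ p.1 p.2) {G M K D : ℝ}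
    (hG : 0 ≤ G) (hlip : ∀ z w w', |ℓ z w - ℓ z w'| ≤ G * ‖w - w'‖) (h0 : ∀ z, |ℓ z 0| ≤ K)
    {u : (Fin m → Z) → F} (hu : Measurable u) (hM : ∀ z, ‖u z‖ ≤ M)
    (hD : ∀ z z', ∑ i, ‖u (Function.update z i z') - u z‖ ≤ D) :
    ∫ z, (∫ x, ℓ x (u z) ∂ρ) ∂(Measure.pi fun _ => ρ) ≤
      ∫ z, (m : ℝ)⁻¹ * ∑ i, ℓ (z i) (u z) ∂(Measure.pi fun _ => ρ) + G * D / m := by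
  set μ : Measure (Fin m → Z) := Measure.pi fun _ => ρ with hμ
  have hbd : ∀ x z, ‖ℓ x (u z)‖ ≤ K + G * M := by
    intro x z
    have h1 := hlip x (u z) 0
    have h2 := h0 x
    have h3 := mul_le_mul_of_nonneg_left (hM z) hG
    rw [sub_zero] at h1
    rw [Real.norm_eq_abs]
    have := abs_sub_abs_le_abs_sub (ℓ x (u z)) (ℓ x 0)
    linarith
  have hint : ∀ {α : Type _} [MeasurableSpace α] (ν : Measure α) [IsProbabilityMeasure ν]
      (a : α → Z) (b : α → Fin m → Z), Measurable a → Measurable b →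
      Integrable (fun p => ℓ (a p) (u (b p))) ν := fun ν _ a b ha hb =>
    Integrable.of_bound (hℓ.comp (ha.prodMk (hu.comp hb))).aestronglyMeasurable (K + G * M)
      (ae_of_all _ fun p => hbd _ _)
  have hupd : ∀ i, Measurable fun p : (Fin m → Z) × Z => Function.update p.1 i p.2 := fun i =>
    measurable_fst.comp (measurePreserving_update ρ i).measurable
  have hev : ∀ i : Fin m, Measurable fun p : (Fin m → Z) × Z => p.1 i := fun i =>
    (measurable_pi_apply i).comp measurable_fst
  -- After the exchange `z i` is the test point, and the output is trained on the sample in which a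
  -- fresh point replaces it.
  have h1 : ∀ i : Fin m, ∫ z, (∫ x, ℓ x (u z) ∂ρ) ∂μ =
      ∫ p, ℓ (p.1 i) (u (Function.update p.1 i p.2)) ∂(μ.prod ρ) := by
    intro i
    have hI := hint (μ.prod ρ) Prod.snd Prod.fst measurable_snd measurable_fst
    rw [← integral_prod _ hI]
    have := (measurePreserving_update ρ i).map_eq
    conv_lhs => rw [hμ, ← this]
    rw [integral_map (measurePreserving_update ρ i).measurable.aemeasurable]
    rw [this]
    exact hI.aestronglyMeasurable
  have h2 : ∀ i : Fin m, ∫ z, ℓ (z i) (u z) ∂μ = ∫ p, ℓ (p.1 i) (u p.1) ∂(μ.prod ρ) := by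
    intro i
    rw [integral_prod _ (hint (μ.prod ρ) _ _ (hev i) measurable_fst)]
    simp
  have hm0 : (0 : ℝ) < m := by exact_mod_cast hm
  have hI1 : ∀ i : Fin m,
      Integrable (fun p => ℓ (p.1 i) (u (Function.update p.1 i p.2))) (μ.prod ρ) :=
    fun i => hint (μ.prod ρ) _ _ (hev i) (hupd i)
  have hI2 : ∀ i : Fin m, Integrable (fun p => ℓ (p.1 i) (u p.1)) (μ.prod ρ) :=
    fun i => hint (μ.prod ρ) _ _ (hev i) measurable_fst
  -- Multiplying by `m` produces one exchange per index, so only the sum over `i` of the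
  -- displacements has to be bounded.
  have key : (m : ℝ) * ∫ z, (∫ x, ℓ x (u z) ∂ρ) ∂μ ≤ ∑ i, ∫ z, ℓ (z i) (u z) ∂μ + G * D := by
    have e1 : (m : ℝ) * ∫ z, (∫ x, ℓ x (u z) ∂ρ) ∂μ =
        ∑ i, ∫ p, ℓ (p.1 i) (u (Function.update p.1 i p.2)) ∂(μ.prod ρ) := by
      simp [← h1]
    rw [e1, Finset.sum_congr rfl fun i _ => h2 i, ← sub_le_iff_le_add',
      ← Finset.sum_sub_distrib, Finset.sum_congr rfl fun i _ => (integral_sub (hI1 i) (hI2 i)).symm,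
      ← integral_finsetSum (f := fun (i : Fin m) (p : (Fin m → Z) × Z) =>
        ℓ (p.1 i) (u (Function.update p.1 i p.2)) - ℓ (p.1 i) (u p.1)) _
        fun i _ => (hI1 i).sub (hI2 i)]
    have : G * D = ∫ _ : (Fin m → Z) × Z, G * D ∂(μ.prod ρ) := by simp
    rw [this]
    refine integral_mono (integrable_finsetSum _ fun i _ => (hI1 i).sub (hI2 i))
      (integrable_const _) fun p => ?_
    refine le_trans ?_ (mul_le_mul_of_nonneg_left (hD p.1 p.2) hG)
    rw [Finset.mul_sum]
    exact Finset.sum_le_sum fun i _ => (le_abs_self _).trans (hlip _ _ _)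
  rw [integral_const_mul, integral_finsetSum (f := fun (i : Fin m) (z : Fin m → Z) => ℓ (z i) (u z)) _
    fun i _ => hint μ (fun z => z i) _ (measurable_pi_apply i) measurable_id, ← div_eq_inv_mul, ← add_div, le_div_iff₀ hm0]
  linarith

/-! ### Convex smooth losses and a single gradient step -/

section Loss

variable {Y : Set ℝ} {V : ℝ → ℝ → ℝ} {L : ℝ}

theorem leftDeriv_eq_deriv (hs : SmoothAssumption Y V L) {y : ℝ} (hy : y ∈ Y) (a : ℝ) :
    leftDeriv V y a = deriv (V y) a :=
  ((hs y hy).1 a).derivWithin (uniqueDiffWithinAt_Iio a)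

variable {X F : Type*} [NormedAddCommGroup F] [InnerProductSpace ℝ F]
  {Φ : X → F} {κ a₀ : ℝ}

theorem BoundedAssumption.abs_deriv_le (hb : BoundedAssumption Y V Φ κ a₀)
    (hs : SmoothAssumption Y V L) {y : ℝ} (hy : y ∈ Y) (a : ℝ) : |deriv (V y) a| ≤ a₀ :=
  leftDeriv_eq_deriv hs hy a ▸ hb.leftDeriv_le y hy a

theorem BoundedAssumption.abs_sub_le (hb : BoundedAssumption Y V Φ κ a₀)
    (hs : SmoothAssumption Y V L) {y : ℝ} (hy : y ∈ Y) (a b : ℝ) :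
    |V y a - V y b| ≤ a₀ * |a - b| :=
  convex_univ.norm_image_sub_le_of_norm_deriv_le (fun x _ => (hs y hy).1 x)
    (fun x _ => hb.abs_deriv_le hs hy x) (Set.mem_univ b) (Set.mem_univ a)

theorem BoundedAssumption.norm_feature_le (hb : BoundedAssumption Y V Φ κ a₀) (x : X) :
    ‖Φ x‖ ≤ κ := by
  have := hb.isLUB_kernel.1 (Set.mem_range_self x)
  rwa [real_inner_self_eq_norm_sq, Real.sqrt_sq (norm_nonneg _)] at this

theorem BoundedAssumption.deriv_monotone (hb : BoundedAssumption Y V Φ κ a₀)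
    (hs : SmoothAssumption Y V L) {y : ℝ} (hy : y ∈ Y) : Monotone (deriv (V y)) := by
  have := (hb.convex y hy).monotoneOn_deriv fun x _ => (hs y hy).1 x
  exact monotoneOn_univ.1 this

/-- The graph lies above its tangent at `a`. This turns the cross term of a gradient step into a
difference of losses. -/
theorem BoundedAssumption.add_deriv_mul_le (hb : BoundedAssumption Y V Φ κ a₀)
    (hs : SmoothAssumption Y V L) {y : ℝ} (hy : y ∈ Y) (a b : ℝ) :
    V y a - V y b ≤ deriv (V y) a * (a - b) := by
  have hc := hb.convex y hy
  rcases lt_trichotomy a b with h | h | h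
  · have := hc.deriv_le_slope (Set.mem_univ a) (Set.mem_univ b) h ((hs y hy).1 a)
    rw [slope_def_field, le_div_iff₀ (sub_pos.2 h)] at this
    linarith
  · simp [h]
  · have := hc.slope_le_deriv (Set.mem_univ b) (Set.mem_univ a) h ((hs y hy).1 a)
    rw [slope_def_field, div_le_iff₀ (sub_pos.2 h)] at this
    linarith

/-- The loss at the observation `z` of the linear function with parameter `w`. -/
def pointLoss (V : ℝ → ℝ → ℝ) (Φ : X → F) (z : X × Y) (w : F) : ℝ :=
  V z.2 (inner ℝ w (Φ z.1))

/-- One stochastic gradient step. -/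
noncomputable def gradStep (V : ℝ → ℝ → ℝ) (Φ : X → F) (h : ℝ) (z : X × Y) (w : F) : F :=
  w - (h * leftDeriv V z.2 (inner ℝ w (Φ z.1))) • Φ z.1

/-- No sign is assumed for `κ` and `a₀`; a single observation forces both. -/
theorem BoundedAssumption.nonneg (hb : BoundedAssumption Y V Φ κ a₀) (z : X × Y) :
    0 ≤ κ ∧ 0 ≤ a₀ :=
  ⟨(norm_nonneg _).trans (hb.norm_feature_le z.1),
    (abs_nonneg _).trans (hb.leftDeriv_le z.2 z.2.2 0)⟩

theorem BoundedAssumption.pointLoss_lipschitz (hb : BoundedAssumption Y V Φ κ a₀)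
    (hs : SmoothAssumption Y V L) (z : X × Y) (w w' : F) :
    |pointLoss V Φ z w - pointLoss V Φ z w'| ≤ a₀ * κ * ‖w - w'‖ := by
  have ha := (hb.nonneg z).2
  refine (hb.abs_sub_le hs z.2.2 _ _).trans ?_
  rw [mul_assoc]
  refine mul_le_mul_of_nonneg_left ?_ ha
  rw [← inner_sub_left, mul_comm]
  exact (abs_real_inner_le_norm _ _).trans
    (mul_le_mul_of_nonneg_left (hb.norm_feature_le _) (norm_nonneg _))

theorem BoundedAssumption.norm_gradient_le (hb : BoundedAssumption Y V Φ κ a₀) (z : X × Y)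
    {h : ℝ} (hh : 0 ≤ h) (a : ℝ) :
    ‖(h * leftDeriv V z.2 a) • Φ z.1‖ ≤ h * (a₀ * κ) := by
  rw [norm_smul, Real.norm_eq_abs, abs_mul, abs_of_nonneg hh, mul_assoc]
  exact mul_le_mul_of_nonneg_left (mul_le_mul (hb.leftDeriv_le _ z.2.2 _) (hb.norm_feature_le _)
    (norm_nonneg _) (hb.nonneg z).2) hh

theorem BoundedAssumption.norm_gradStep_sub_sq_le (hb : BoundedAssumption Y V Φ κ a₀)
    (hs : SmoothAssumption Y V L) (z : X × Y) {h : ℝ} (hh : 0 ≤ h) (w v : F) :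
    ‖gradStep V Φ h z w - v‖ ^ 2 ≤
      ‖w - v‖ ^ 2 - 2 * h * (pointLoss V Φ z w - pointLoss V Φ z v) + h ^ 2 * (a₀ * κ) ^ 2 := by
  have h1 : gradStep V Φ h z w - v =
      (w - v) - (h * leftDeriv V z.2 (inner ℝ w (Φ z.1))) • Φ z.1 := by
    unfold gradStep; abel
  have h2 := pow_le_pow_left₀ (norm_nonneg _)
    (hb.norm_gradient_le z hh (inner ℝ w (Φ z.1))) 2
  rw [h1, norm_sub_sq_real, real_inner_smul_right, inner_sub_left]
  have h3 := hb.add_deriv_mul_le hs z.2.2 (inner ℝ w (Φ z.1)) (inner ℝ v (Φ z.1))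
  rw [← leftDeriv_eq_deriv hs z.2.2] at h3
  have h4 := mul_le_mul_of_nonneg_left h3 hh
  rw [mul_pow] at h2
  unfold pointLoss
  linarith

/-- A monotone `L`-Lipschitz derivative is co-coercive: `d² ≤ L d (a - b)`. Hence the quadratic term
of the expanded square is at most `h² κ² L d (a - b)`, which the cross term `-2 h d (a - b)` absorbs
under `hstep`. -/
theorem BoundedAssumption.gradStep_nonexpansive (hb : BoundedAssumption Y V Φ κ a₀)
    (hs : SmoothAssumption Y V L) (z : X × Y) {h : ℝ} (hh : 0 ≤ h)
    (hstep : h * (κ ^ 2 * L) ≤ 2) (w v : F) :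
    ‖gradStep V Φ h z w - gradStep V Φ h z v‖ ≤ ‖w - v‖ := by
  have hΦ := pow_le_pow_left₀ (norm_nonneg _) (hb.norm_feature_le z.1) 2
  refine le_of_sq_le_sq ?_ (norm_nonneg _)
  set a : ℝ := inner ℝ w (Φ z.1) with ha
  set b : ℝ := inner ℝ v (Φ z.1) with hbdef
  have hm := hb.deriv_monotone hs z.2.2
  have hlip := (hs z.2 z.2.2).2 b a
  rw [← leftDeriv_eq_deriv hs z.2.2, ← leftDeriv_eq_deriv hs z.2.2] at hlip
  have hmono : 0 ≤ (leftDeriv V z.2 a - leftDeriv V z.2 b) * (a - b) := by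
    rw [leftDeriv_eq_deriv hs z.2.2, leftDeriv_eq_deriv hs z.2.2]
    rcases le_total a b with hab | hab
    · exact mul_nonneg_of_nonpos_of_nonpos (sub_nonpos.2 (hm hab)) (sub_nonpos.2 hab)
    · exact mul_nonneg (sub_nonneg.2 (hm hab)) (sub_nonneg.2 hab)
  set d := leftDeriv V z.2 a - leftDeriv V z.2 b with hd
  have hdd : d ^ 2 ≤ L * (d * (a - b)) := by
    rw [← abs_of_nonneg hmono, abs_mul, ← sq_abs]
    nlinarith [abs_nonneg d]
  have h1 : gradStep V Φ h z w - gradStep V Φ h z v = (w - v) - (h * d) • Φ z.1 := by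
    unfold gradStep
    rw [hd, mul_sub, sub_smul]; abel
  have hab : inner ℝ (w - v) (Φ z.1) = a - b := inner_sub_left _ _ _
  rw [h1, norm_sub_sq_real, real_inner_smul_right, hab, norm_smul, mul_pow, Real.norm_eq_abs,
    sq_abs]
  have h5 : (h * d) ^ 2 * ‖Φ z.1‖ ^ 2 ≤ (h * d) ^ 2 * κ ^ 2 :=
    mul_le_mul_of_nonneg_left hΦ (sq_nonneg _)
  have h6 : (h * d) ^ 2 * κ ^ 2 ≤ h ^ 2 * κ ^ 2 * (L * (d * (a - b))) := by
    have := mul_le_mul_of_nonneg_left hdd (by positivity : 0 ≤ h ^ 2 * κ ^ 2)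
    linarith
  have h7 : h ^ 2 * κ ^ 2 * (L * (d * (a - b))) ≤ 2 * (h * (d * (a - b))) := by
    have := mul_le_mul_of_nonneg_right hstep (mul_nonneg hh hmono)
    linarith
  linarith

end Loss

/-! ### Size and stability of the iterates -/

section Iterates

variable {X : Type*} {Y : Set ℝ}
  {F : Type*} [NormedAddCommGroup F] [InnerProductSpace ℝ F] {V : ℝ → ℝ → ℝ} {Φ : X → F}
  {η : ℕ → ℝ} {m T : ℕ} {κ a₀ L : ℝ}

theorem iterate_succ_of_mem (z : Fin m → X × Y) (J : Finset.Icc 1 T → Fin m) {k : ℕ}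
    (h : k ∈ Finset.Icc 1 T) :
    iterate V Φ η z J (k + 1) = gradStep V Φ (η k) (z (J ⟨k, h⟩)) (iterate V Φ η z J k) := by
  simp only [iterate, dif_pos h, gradStep]

theorem iterate_succ_of_notMem (z : Fin m → X × Y) (J : Finset.Icc 1 T → Fin m) {k : ℕ}
    (h : k ∉ Finset.Icc 1 T) :
    iterate V Φ η z J (k + 1) = iterate V Φ η z J k := by
  simp only [iterate, dif_neg h]

theorem iterate_one (z : Fin m → X × Y) (J : Finset.Icc 1 T → Fin m) :
    iterate V Φ η z J 1 = 0 := by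
  rw [iterate_succ_of_notMem z J (by simp)]; rfl

/-- The `k`-th iterate only depends on the indices before time `k`. -/
theorem iterate_congr (z : Fin m → X × Y) {J J' : Finset.Icc 1 T → Fin m} {k : ℕ}
    (h : ∀ i : Finset.Icc 1 T, (i : ℕ) < k → J i = J' i) :
    iterate V Φ η z J k = iterate V Φ η z J' k := by
  induction k with
  | zero => rfl
  | succ k ih =>
    have ih := ih fun i hi => h i (by omega)
    by_cases hk : k ∈ Finset.Icc 1 T
    · rw [iterate_succ_of_mem z J hk, iterate_succ_of_mem z J' hk, ih,
        h ⟨k, hk⟩ (Nat.lt_succ_self k)]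
    · rw [iterate_succ_of_notMem z J hk, iterate_succ_of_notMem z J' hk, ih]

/-- A crude bound, needed only for integrability. The absolute value covers an empty sample, where
the sign of `a₀ * κ` is unknown. -/
theorem BoundedAssumption.norm_iterate_le (hb : BoundedAssumption Y V Φ κ a₀)
    (hη : ∀ k, 0 ≤ η k) (z : Fin m → X × Y) (J : Finset.Icc 1 T → Fin m) (k : ℕ) :
    ‖iterate V Φ η z J k‖ ≤ ∑ i ∈ Finset.range k, η i * |a₀ * κ| := by
  induction k with
  | zero => simp [iterate]
  | succ k ih =>
    rw [Finset.sum_range_succ]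
    by_cases hk : k ∈ Finset.Icc 1 T
    · rw [iterate_succ_of_mem z J hk, gradStep]
      refine (norm_sub_le _ _).trans (add_le_add ih ((hb.norm_gradient_le _ (hη k) _).trans ?_))
      exact mul_le_mul_of_nonneg_left (le_abs_self _) (hη k)
    · rw [iterate_succ_of_notMem z J hk]
      have := mul_nonneg (hη k) (abs_nonneg (a₀ * κ))
      linarith

/-- On-average stability of the iterates under replacement of one observation. -/
theorem BoundedAssumption.sum_norm_iterate_update_le (hb : BoundedAssumption Y V Φ κ a₀)
    (hs : SmoothAssumption Y V L) (hη : ∀ k, 0 ≤ η k)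
    (hstep : ∀ k, η k * (κ ^ 2 * L) ≤ 2) (z : Fin m → X × Y) (z' : X × Y)
    (J : Finset.Icc 1 T → Fin m) (k : ℕ) :
    ∑ i, ‖iterate V Φ η (Function.update z i z') J k - iterate V Φ η z J k‖ ≤
      2 * (a₀ * κ) * ∑ l ∈ Finset.range k, η l := by
  have hG : 0 ≤ a₀ * κ := mul_nonneg (hb.nonneg z').2 (hb.nonneg z').1
  induction k with
  | zero => simp [iterate]
  | succ k ih =>
    rw [Finset.sum_range_succ, mul_add]
    by_cases hk : k ∈ Finset.Icc 1 T
    -- If `i` is not the drawn index, both runs apply the same nonexpansive map. Only the drawn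
    -- index pays for two gradients, so the sum over `i` gains a single such term.
    · have step : ∀ i, ‖iterate V Φ η (Function.update z i z') J (k + 1)
          - iterate V Φ η z J (k + 1)‖ ≤
          ‖iterate V Φ η (Function.update z i z') J k - iterate V Φ η z J k‖ +
            if J ⟨k, hk⟩ = i then 2 * (a₀ * κ) * η k else 0 := by
        intro i
        rw [iterate_succ_of_mem _ J hk, iterate_succ_of_mem _ J hk]
        split_ifs with hi
        · unfold gradStep
          rw [sub_sub_sub_comm]
          refine (norm_sub_le _ _).trans (add_le_add le_rfl ((norm_sub_le _ _).trans ?_))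
          have h1 := hb.norm_gradient_le (Function.update z i z' (J ⟨k, hk⟩)) (hη k)
            (inner ℝ (iterate V Φ η (Function.update z i z') J k)
              (Φ (Function.update z i z' (J ⟨k, hk⟩)).1))
          have h2 := hb.norm_gradient_le (z (J ⟨k, hk⟩)) (hη k)
            (inner ℝ (iterate V Φ η z J k) (Φ (z (J ⟨k, hk⟩)).1))
          linarith
        · rw [Function.update_of_ne hi, add_zero]
          exact hb.gradStep_nonexpansive hs _ (hη k) (hstep k) _ _
      refine (Finset.sum_le_sum fun i _ => step i).trans ?_
      rw [Finset.sum_add_distrib]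
      simpa using ih
    · simp only [iterate_succ_of_notMem _ J hk]
      have := mul_nonneg (mul_nonneg zero_le_two hG) (hη k)
      linarith

end Iterates

/-! ### Measurability of the loss and of the iterates -/

section Measurability

variable {X : Type*} [MeasurableSpace X] {Y : Set ℝ}
  {F : Type*} [NormedAddCommGroup F] [InnerProductSpace ℝ F] [CompleteSpace F]
  [TopologicalSpace.SeparableSpace F] [MeasurableSpace F] [BorelSpace F]
  {V : ℝ → ℝ → ℝ} {Φ : X → F} {L : ℝ}

/-- On `Y` the left derivative is the full derivative, hence a pointwise limit of measurable right
difference quotients. -/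
theorem measurable_leftDeriv (hV : Measurable fun p : ℝ × ℝ => V p.1 p.2)
    (hs : SmoothAssumption Y V L) : Measurable fun p : Y × ℝ => leftDeriv V p.1 p.2 := by
  refine measurable_of_tendsto_metrizable
    (f := fun (n : ℕ) (p : Y × ℝ) =>
      (V p.1 (p.2 + 1 / ((n : ℝ) + 1)) - V p.1 p.2) * ((n : ℝ) + 1)) (fun n => ?_) ?_
  · have h1 : Measurable fun p : Y × ℝ => ((p.1 : ℝ), p.2 + 1 / ((n : ℝ) + 1)) := by fun_prop
    have h2 : Measurable fun p : Y × ℝ => ((p.1 : ℝ), p.2) := by fun_prop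
    exact ((hV.comp h1).sub (hV.comp h2)).mul_const _
  · rw [tendsto_pi_nhds]
    rintro ⟨y, a⟩
    rw [leftDeriv_eq_deriv hs y.2]
    have hd := (((hs y y.2).1 a).hasDerivAt.tendsto_slope_zero_right)
    have hseq : Filter.Tendsto (fun n : ℕ => 1 / ((n : ℝ) + 1)) Filter.atTop
        (nhdsWithin 0 (Set.Ioi 0)) :=
      tendsto_nhdsWithin_iff.2 ⟨tendsto_one_div_add_atTop_nhds_zero_nat,
        Filter.Eventually.of_forall fun n => by simp only [Set.mem_Ioi]; positivity⟩
    refine (hd.comp hseq).congr fun n => ?_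
    simp [mul_comm]

theorem measurable_pointLoss (hV : Measurable fun p : ℝ × ℝ => V p.1 p.2) (hΦ : Measurable Φ) :
    Measurable fun p : (X × Y) × F => pointLoss V Φ p.1 p.2 := by
  have h2 : Measurable fun p : (X × Y) × F => (inner ℝ p.2 (Φ p.1.1) : ℝ) :=
    measurable_snd.inner (hΦ.comp (measurable_fst.comp measurable_fst))
  have h1 : Measurable fun p : (X × Y) × F => (p.1.2 : ℝ) :=
    measurable_subtype_coe.comp (measurable_snd.comp measurable_fst)
  exact hV.comp (h1.prodMk h2)

theorem measurable_iterate (hV : Measurable fun p : ℝ × ℝ => V p.1 p.2) (hΦ : Measurable Φ)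
    (hs : SmoothAssumption Y V L) {η : ℕ → ℝ} {m T : ℕ} (J : Finset.Icc 1 T → Fin m) (k : ℕ) :
    Measurable fun z : Fin m → X × Y => iterate V Φ η z J k := by
  induction k with
  | zero => exact measurable_const
  | succ k ih =>
    by_cases hk : k ∈ Finset.Icc 1 T
    · simp only [iterate_succ_of_mem _ J hk, gradStep]
      have hz : Measurable fun z : Fin m → X × Y => z (J ⟨k, hk⟩) := measurable_pi_apply _
      have hf : Measurable fun z : Fin m → X × Y => Φ (z (J ⟨k, hk⟩)).1 :=
        hΦ.comp (measurable_fst.comp hz)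
      have hd := (measurable_leftDeriv hV hs).comp
        ((measurable_snd.comp hz).prodMk (ih.inner hf (𝕜 := ℝ)))
      exact ih.sub ((hd.const_mul (η k)).smul hf)
    · simpa only [iterate_succ_of_notMem _ J hk] using ih

end Measurability

/-! ### Optimization error, conditionally on the sample -/

/-- Averaging over one independent uniform coordinate. -/
theorem expect_resample {ι κ : Type*} [Fintype ι] [DecidableEq ι] [Fintype κ] [Nonempty κ]
    (i : ι) (ψ : κ → (ι → κ) → ℝ) (hψ : ∀ j J k, ψ j (Function.update J i k) = ψ j J) :
    𝔼 J, ψ (J i) J = 𝔼 J, 𝔼 j, ψ j J := by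
  have hprod : ∀ f : (ι → κ) → κ → ℝ, 𝔼 J, 𝔼 j, f J j = 𝔼 p : (ι → κ) × κ, f p.1 p.2 := by
    intro f
    rw [← Finset.univ_product_univ, Finset.expect_product]
  -- The exchange of coordinate `i` with an independent copy is an involution.
  let e : (ι → κ) × κ ≃ (ι → κ) × κ :=
    { toFun := fun p => (Function.update p.1 i p.2, p.1 i)
      invFun := fun p => (Function.update p.1 i p.2, p.1 i)
      left_inv := fun p => by simp
      right_inv := fun p => by simp }
  calc 𝔼 J, ψ (J i) J = 𝔼 J : ι → κ, 𝔼 _j : κ, ψ (J i) J := by simp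
    _ = 𝔼 p : (ι → κ) × κ, ψ (p.1 i) p.1 := hprod fun J _ => ψ (J i) J
    _ = 𝔼 p : (ι → κ) × κ, ψ p.2 p.1 :=
        Fintype.expect_equiv e _ _ fun p => by simp [e, hψ]
    _ = 𝔼 J, 𝔼 j, ψ j J := (hprod fun J j => ψ j J).symm

section Optimization

variable {X : Type*} {Y : Set ℝ}
  {F : Type*} [NormedAddCommGroup F] [InnerProductSpace ℝ F] {V : ℝ → ℝ → ℝ} {Φ : X → F}
  {η : ℕ → ℝ} {m t : ℕ} {κ a₀ L : ℝ}

/-- The empirical risk on the sample `z`. -/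
noncomputable def empRisk (V : ℝ → ℝ → ℝ) (Φ : X → F) (z : Fin m → X × Y) (w : F) : ℝ :=
  (m : ℝ)⁻¹ * ∑ i, pointLoss V Φ (z i) w

theorem empRisk_eq_expect (z : Fin m → X × Y) (w : F) :
    empRisk V Φ z w = 𝔼 i, pointLoss V Φ (z i) w := by
  rw [empRisk, Fintype.expect_eq_sum_div_card, Fintype.card_fin, div_eq_inv_mul]

theorem BoundedAssumption.convexOn_empRisk (hb : BoundedAssumption Y V Φ κ a₀)
    (z : Fin m → X × Y) : ConvexOn ℝ Set.univ (empRisk V Φ z) := by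
  have hp : ∀ i, ConvexOn ℝ Set.univ (pointLoss V Φ (z i)) := fun i =>
    (hb.convex (z i).2 (z i).2.2).comp_linearMap
      ((innerSL ℝ (Φ (z i).1)).toLinearMap) |>.congr fun w _ => by
        simp [pointLoss, real_inner_comm]
  have hsum : ConvexOn ℝ Set.univ (fun w => ∑ i, pointLoss V Φ (z i) w) := by
    refine ⟨convex_univ, fun x hx y hy a b ha hb' hab => ?_⟩
    simp only [smul_eq_mul, Finset.mul_sum, ← Finset.sum_add_distrib]
    exact Finset.sum_le_sum fun i _ => (hp i).2 hx hy ha hb' hab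
  exact hsum.smul (by positivity : (0 : ℝ) ≤ (m : ℝ)⁻¹)

/-- Conditionally on the sample, stochastic gradient steps decrease the distance to any comparator
chosen before time `r`, up to the excess empirical risk and the squared step-sizes. -/
theorem BoundedAssumption.two_mul_sum_excess_le (hb : BoundedAssumption Y V Φ κ a₀)
    (hs : SmoothAssumption Y V L) (hη : ∀ k, 0 ≤ η k) (hm : 1 ≤ m) (z : Fin m → X × Y)
    {r s : ℕ} (hr : 1 ≤ r) (hrs : r ≤ s) (hst : s ≤ t + 1) (v : (Finset.Icc 1 t → Fin m) → F)
    (hv : ∀ J J', (∀ i : Finset.Icc 1 t, (i : ℕ) < r → J i = J' i) → v J = v J') :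
    2 * ∑ k ∈ Finset.Ico r s, η k * ((𝔼 J : Finset.Icc 1 t → Fin m,
        empRisk V Φ z (iterate V Φ η z J k)) - 𝔼 J, empRisk V Φ z (v J)) ≤
      (𝔼 J : Finset.Icc 1 t → Fin m, ‖iterate V Φ η z J r - v J‖ ^ 2)
        - (𝔼 J : Finset.Icc 1 t → Fin m, ‖iterate V Φ η z J s - v J‖ ^ 2)
        + (a₀ * κ) ^ 2 * ∑ k ∈ Finset.Ico r s, η k ^ 2 := by
  have : Nonempty (Fin m) := ⟨⟨0, hm⟩⟩
  induction s, hrs using Nat.le_induction with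
  | base => simp
  | succ s hrs ih =>
    have ih := ih (by omega)
    rw [Finset.sum_Ico_succ_top hrs, Finset.sum_Ico_succ_top hrs]
    have hk : s ∈ Finset.Icc 1 t := by simp only [Finset.mem_Icc]; omega
    -- `u` ignores the index drawn at time `s`, so averaging over that index turns the sampled loss
    -- into the empirical risk.
    have resample : ∀ u : (Finset.Icc 1 t → Fin m) → F,
        (∀ J J', (∀ i : Finset.Icc 1 t, (i : ℕ) < s → J i = J' i) → u J = u J') →
        𝔼 J, pointLoss V Φ (z (J ⟨s, hk⟩)) (u J) = 𝔼 J, empRisk V Φ z (u J) := by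
      intro u hu
      simp only [empRisk_eq_expect]
      refine expect_resample ⟨s, hk⟩ (fun j J => pointLoss V Φ (z j) (u J)) fun j J k => ?_
      have : u (Function.update J ⟨s, hk⟩ k) = u J := hu _ _ fun i hi => by
        rw [Function.update_of_ne]
        rintro rfl
        exact lt_irrefl _ hi
      simp only [this]
    have e1 := resample (fun J => iterate V Φ η z J s) fun J J' h => iterate_congr z h
    have e2 := resample v fun J J' h => hv J J' fun i hi => h i (by omega)
    have step : (𝔼 J : Finset.Icc 1 t → Fin m, ‖iterate V Φ η z J (s + 1) - v J‖ ^ 2) ≤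
        (𝔼 J : Finset.Icc 1 t → Fin m, ‖iterate V Φ η z J s - v J‖ ^ 2)
        - 2 * η s * ((𝔼 J : Finset.Icc 1 t → Fin m, empRisk V Φ z (iterate V Φ η z J s))
          - 𝔼 J, empRisk V Φ z (v J)) + η s ^ 2 * (a₀ * κ) ^ 2 := by
      rw [← e1, ← e2, ← Finset.expect_sub_distrib, Finset.mul_expect, ← Finset.expect_sub_distrib,
        ← Fintype.expect_const (ι := Finset.Icc 1 t → Fin m) (η s ^ 2 * (a₀ * κ) ^ 2),
        ← Finset.expect_add_distrib]
      refine Finset.expect_le_expect fun J _ => ?_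
      rw [iterate_succ_of_mem z J hk]
      exact hb.norm_gradStep_sub_sq_le hs _ (hη s) _ _
    linarith

/-- Used with a constant `v`, and with `v = w_r`, where the distance term vanishes and the suffix
hypothesis of `last_le` results. -/
theorem BoundedAssumption.sum_excess_le (hb : BoundedAssumption Y V Φ κ a₀)
    (hs : SmoothAssumption Y V L) (hη : ∀ k, 0 ≤ η k) (hm : 1 ≤ m) (z : Fin m → X × Y)
    {r : ℕ} (hr : 1 ≤ r) (hrt : r ≤ t) (v : (Finset.Icc 1 t → Fin m) → F)
    (hv : ∀ J J', (∀ i : Finset.Icc 1 t, (i : ℕ) < r → J i = J' i) → v J = v J') :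
    ∑ k ∈ Finset.Ico r (t + 1), η k * ((𝔼 J : Finset.Icc 1 t → Fin m,
        empRisk V Φ z (iterate V Φ η z J k)) - 𝔼 J, empRisk V Φ z (v J)) ≤
      (𝔼 J : Finset.Icc 1 t → Fin m, ‖iterate V Φ η z J r - v J‖ ^ 2) / 2
        + (a₀ * κ) ^ 2 / 2 * ∑ k ∈ Finset.Ico r (t + 1), η k ^ 2 := by
  have h := hb.two_mul_sum_excess_le hs hη hm z hr (hrt.trans (Nat.le_succ t)) le_rfl v hv
  have : 0 ≤ 𝔼 J : Finset.Icc 1 t → Fin m, ‖iterate V Φ η z J (t + 1) - v J‖ ^ 2 :=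
    Finset.expect_nonneg fun _ _ => sq_nonneg _
  linarith

/-- Optimization error of the averaged and of the last iterate, conditionally on the sample. -/
theorem BoundedAssumption.expect_empRisk_le (hb : BoundedAssumption Y V Φ κ a₀)
    (hs : SmoothAssumption Y V L) {η₁ : ℝ} (hη₁ : 0 < η₁) (hm : 1 ≤ m) (ht : 1 ≤ t)
    {g : (Fin m → X × Y) → (Finset.Icc 1 t → Fin m) → F}
    (hg : IsOutput V Φ (fun k => η₁ / √(k : ℝ)) t g) (z : Fin m → X × Y) (w : F) :
    𝔼 J, empRisk V Φ z (g z J) ≤ empRisk V Φ z w + (1 / (η₁ * √(t : ℝ))) / 2 * ‖w‖ ^ 2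
      + 3 * ((a₀ * κ) ^ 2 / 2) * η₁ * ((1 + Real.log t) / √(t : ℝ)) := by
  have : Nonempty (Fin m) := ⟨⟨0, hm⟩⟩
  have hη : ∀ k : ℕ, 0 ≤ η₁ / √(k : ℝ) := fun k => by positivity
  have h0 := hb.sum_excess_le hs hη hm z le_rfl ht (fun _ => w) fun _ _ _ => rfl
  simp only [iterate_one, zero_sub, norm_neg, Fintype.expect_const] at h0
  rcases hg with rfl | rfl
  · refine le_trans ?_ (average_le hη₁ ht (by positivity) (sq_nonneg _) h0)
    have hJ : ∀ J : Finset.Icc 1 t → Fin m,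
        empRisk V Φ z (averagedIterate V Φ (fun k => η₁ / √(k : ℝ)) z J t) ≤
        (∑ i ∈ Finset.Ico 1 (t + 1), η₁ / √(i : ℝ) *
          empRisk V Φ z (iterate V Φ (fun k => η₁ / √(k : ℝ)) z J i)) /
          ∑ i ∈ Finset.Ico 1 (t + 1), η₁ / √(i : ℝ) := by
      intro J
      -- The averaged iterate is a centre of mass, so this is Jensen's inequality.
      have := (hb.convexOn_empRisk z).map_centerMass_le (t := Finset.Icc 1 t)
        (w := fun k : ℕ => η₁ / √(k : ℝ)) (p := fun k => iterate V Φ (fun k => η₁ / √(k : ℝ)) z J k)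
        (fun i _ => hη i)
        (Finset.sum_pos (fun i hi => stepSize_pos hη₁ (Finset.mem_Icc.1 hi).1) ⟨1, by simpa⟩)
        (fun i _ => Set.mem_univ _)
      rw [div_eq_inv_mul]
      exact this
    refine (Finset.expect_le_expect fun J _ => hJ J).trans (le_of_eq ?_)
    rw [← Finset.expect_div, Finset.expect_sum_comm]
    simp only [Finset.mul_expect]
  · refine last_le hη₁ (e := fun k => 𝔼 J : Finset.Icc 1 t → Fin m,
      empRisk V Φ z (iterate V Φ (fun k => η₁ / √(k : ℝ)) z J k)) ht (by positivity)
      (sq_nonneg _) h0 fun r hr hrt => ?_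
    have := hb.sum_excess_le hs hη hm z hr hrt
      (fun J => iterate V Φ (fun k => η₁ / √(k : ℝ)) z J r) fun _ _ h => iterate_congr z h
    simpa using this

end Optimization

/-! ### Index averages and sums of step sizes -/

/-- The index space is finite: expectations over `J` become finite averages, which commute freely
with integrals over the sample. -/
theorem integral_indexLaw {m T : ℕ} (hm : 1 ≤ m) (f : (Finset.Icc 1 T → Fin m) → ℝ) :
    ∫ J, f J ∂(indexLaw m T) = 𝔼 J, f J := by
  have : Nonempty (Fin m) := ⟨⟨0, hm⟩⟩
  have : IsProbabilityMeasure (indexLaw m T) := by unfold indexLaw; infer_instance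
  rw [integral_fintype .of_finite, Fintype.expect_eq_sum_div_card, Finset.sum_div]
  refine Finset.sum_congr rfl fun J _ => ?_
  have h1 : (indexLaw m T).real {J} = (Fintype.card (Finset.Icc 1 T → Fin m) : ℝ)⁻¹ := by
    rw [measureReal_def, indexLaw, Measure.pi_singleton]
    simp [ProbabilityTheory.uniformOn_univ]
  rw [h1, smul_eq_mul, div_eq_inv_mul]

section StepSizes

/-- Telescoping of `1/√(n+1) ≤ 2(√(n+1) - √n)`; the term `k = 0` is zero by the convention for
division by zero. -/
theorem sum_range_stepSize_le {η₁ : ℝ} (hη₁ : 0 < η₁) (n : ℕ) :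
    ∑ k ∈ Finset.range (n + 1), η₁ / √(k : ℝ) ≤ 2 * η₁ * √(n : ℝ) := by
  induction n with
  | zero => simp
  | succ n ih =>
    rw [Finset.sum_range_succ]
    have hb : 0 < √((n + 1 : ℕ) : ℝ) := Real.sqrt_pos.2 (by positivity)
    have h1 := Real.sq_sqrt (Nat.cast_nonneg (α := ℝ) n)
    have h2 := Real.sq_sqrt (Nat.cast_nonneg (α := ℝ) (n + 1))
    set a := √(n : ℝ)
    set b := √((n + 1 : ℕ) : ℝ)
    push_cast at h2
    have h3 : 1 / b ≤ 2 * (b - a) := by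
      rw [div_le_iff₀ hb]
      nlinarith [sq_nonneg (a - b)]
    have h4 := mul_le_mul_of_nonneg_left h3 hη₁.le
    rw [mul_one_div] at h4
    linarith

/-- The factor `log t` vanishes at `t = 1`, but so does the sum, whose only term is `k = 0`. For `t
≥ 2`, `log t ≥ 1/2` doubles the constant. -/
theorem sum_range_stepSize_le_log {η₁ : ℝ} (hη₁ : 0 < η₁) {t : ℕ} (ht : 1 ≤ t) :
    ∑ k ∈ Finset.range t, η₁ / √(k : ℝ) ≤ 4 * η₁ * (√(t : ℝ) * Real.log t) := by
  rcases ht.eq_or_lt with rfl | ht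
  · simp
  · have h1 := sum_range_stepSize_le hη₁ t
    have h2 : ∑ k ∈ Finset.range t, η₁ / √(k : ℝ) ≤
        ∑ k ∈ Finset.range (t + 1), η₁ / √(k : ℝ) := by
      rw [Finset.sum_range_succ]
      have : 0 ≤ η₁ / √(t : ℝ) := by positivity
      linarith
    have h3 : 1 / 2 ≤ Real.log t := by
      have : Real.log 2 ≤ Real.log t := Real.log_le_log (by norm_num) (by exact_mod_cast ht)
      linarith [Real.log_two_gt_d9]
    have h4 := mul_le_mul_of_nonneg_left h3 (by positivity : 0 ≤ 4 * η₁ * √(t : ℝ))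
    linarith

end StepSizes

/-! ### Bounds shared by the averaged and the last iterate -/

section Output

variable {X : Type*} {Y : Set ℝ}
  {F : Type*} [NormedAddCommGroup F] [InnerProductSpace ℝ F] {V : ℝ → ℝ → ℝ} {Φ : X → F}
  {η : ℕ → ℝ} {m t : ℕ} {κ a₀ L : ℝ} {g : (Fin m → X × Y) → (Finset.Icc 1 t → Fin m) → F}

/-- Weighted averages inherit a bound that holds for all terms. -/
theorem inv_sum_mul_sum_le {s : Finset ℕ} (hη : ∀ k, 0 ≤ η k) {a : ℕ → ℝ} {b : ℝ} (hb : 0 ≤ b)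
    (h : ∀ k ∈ s, a k ≤ b) : (∑ k ∈ s, η k)⁻¹ * ∑ k ∈ s, η k * a k ≤ b := by
  have hH : 0 ≤ ∑ k ∈ s, η k := Finset.sum_nonneg fun k _ => hη k
  rcases hH.eq_or_lt with h0 | h0
  · simpa [← h0] using hb
  · rw [inv_mul_le_iff₀ h0, Finset.sum_mul]
    exact Finset.sum_le_sum fun k hk => mul_le_mul_of_nonneg_left (h k hk) (hη k)

theorem norm_inv_sum_smul_sum_le {s : Finset ℕ} (hη : ∀ k, 0 ≤ η k) (w : ℕ → F) :
    ‖(∑ k ∈ s, η k)⁻¹ • ∑ k ∈ s, η k • w k‖ ≤ (∑ k ∈ s, η k)⁻¹ * ∑ k ∈ s, η k * ‖w k‖ := by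
  have hH : 0 ≤ ∑ k ∈ s, η k := Finset.sum_nonneg fun k _ => hη k
  rw [norm_smul, Real.norm_eq_abs, abs_of_nonneg (inv_nonneg.2 hH)]
  refine mul_le_mul_of_nonneg_left ((norm_sum_le _ _).trans (le_of_eq ?_)) (inv_nonneg.2 hH)
  exact Finset.sum_congr rfl fun k _ => by
    rw [norm_smul, Real.norm_eq_abs, abs_of_nonneg (hη k)]

theorem sum_range_le_of_mem_Icc (hη : ∀ k, 0 ≤ η k) {k : ℕ} (hk : k ∈ Finset.Icc 1 t) :
    ∑ i ∈ Finset.range k, η i ≤ ∑ i ∈ Finset.range t, η i :=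
  Finset.sum_le_sum_of_subset_of_nonneg
    (Finset.range_subset_range.2 (Finset.mem_Icc.1 hk).2) fun i _ _ => hη i

theorem BoundedAssumption.norm_output_le (hb : BoundedAssumption Y V Φ κ a₀)
    (hη : ∀ k, 0 ≤ η k) (hg : IsOutput V Φ η t g) (z : Fin m → X × Y)
    (J : Finset.Icc 1 t → Fin m) :
    ‖g z J‖ ≤ |a₀ * κ| * ∑ i ∈ Finset.range t, η i := by
  have hw : ∀ k, ‖iterate V Φ η z J k‖ ≤ |a₀ * κ| * ∑ i ∈ Finset.range k, η i := fun k => by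
    rw [mul_comm, Finset.sum_mul]
    exact hb.norm_iterate_le hη z J k
  rcases hg with rfl | rfl
  · refine (norm_inv_sum_smul_sum_le hη _).trans (inv_sum_mul_sum_le hη ?_ fun k hk =>
      (hw k).trans (mul_le_mul_of_nonneg_left (sum_range_le_of_mem_Icc hη hk) (abs_nonneg _)))
    exact mul_nonneg (abs_nonneg _) (Finset.sum_nonneg fun i _ => hη i)
  · exact hw t

theorem BoundedAssumption.sum_norm_output_update_le (hb : BoundedAssumption Y V Φ κ a₀)
    (hs : SmoothAssumption Y V L) (hη : ∀ k, 0 ≤ η k) (hstep : ∀ k, η k * (κ ^ 2 * L) ≤ 2)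
    (hg : IsOutput V Φ η t g) (z : Fin m → X × Y) (z' : X × Y) (J : Finset.Icc 1 t → Fin m) :
    ∑ i, ‖g (Function.update z i z') J - g z J‖ ≤
      2 * (a₀ * κ) * ∑ l ∈ Finset.range t, η l := by
  have hG : 0 ≤ a₀ * κ := mul_nonneg (hb.nonneg z').2 (hb.nonneg z').1
  have hw := hb.sum_norm_iterate_update_le hs hη hstep z z' J
  rcases hg with rfl | rfl
  · have hi : ∀ i, ‖averagedIterate V Φ η (Function.update z i z') J t
        - averagedIterate V Φ η z J t‖ ≤ (∑ k ∈ Finset.Icc 1 t, η k)⁻¹ * ∑ k ∈ Finset.Icc 1 t,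
          η k * ‖iterate V Φ η (Function.update z i z') J k - iterate V Φ η z J k‖ := by
      intro i
      refine le_trans (le_of_eq ?_) (norm_inv_sum_smul_sum_le hη _)
      simp only [averagedIterate, smul_sub, Finset.sum_sub_distrib]
    refine (Finset.sum_le_sum fun i _ => hi i).trans ?_
    rw [← Finset.mul_sum, Finset.sum_comm]
    simp only [← Finset.mul_sum]
    refine inv_sum_mul_sum_le hη ?_ fun k hk => (hw k).trans
      (mul_le_mul_of_nonneg_left (sum_range_le_of_mem_Icc hη hk) (by positivity))
    exact mul_nonneg (by positivity) (Finset.sum_nonneg fun i _ => hη i)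
  · exact hw t

theorem BoundedAssumption.exists_abs_pointLoss_le (hb : BoundedAssumption Y V Φ κ a₀)
    (hs : SmoothAssumption Y V L) (hV0 : ∀ y a : ℝ, 0 ≤ V y a) :
    ∃ K, (∀ z : X × Y, |pointLoss V Φ z 0| ≤ K) ∧
      ∀ (z : X × Y) w, |pointLoss V Φ z w| ≤ K + a₀ * κ * ‖w‖ := by
  obtain ⟨K, hK⟩ := hb.bddAbove_zero
  have h0 : ∀ z : X × Y, |pointLoss V Φ z 0| ≤ K := fun z => by
    rw [pointLoss, inner_zero_left, abs_of_nonneg (hV0 _ _)]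
    exact hK (Set.mem_image_of_mem _ z.2.2)
  refine ⟨K, h0, fun z w => ?_⟩
  have h1 := hb.pointLoss_lipschitz hs z w 0
  rw [sub_zero] at h1
  have := abs_sub_abs_le_abs_sub (pointLoss V Φ z w) (pointLoss V Φ z 0)
  linarith [h0 z]

theorem integrable_expect {α ι : Type*} [MeasurableSpace α] [Fintype ι] {ν : Measure α}
    {f : ι → α → ℝ} (hf : ∀ i, Integrable (f i) ν) : Integrable (fun a => 𝔼 i, f i a) ν := by
  simp only [Fintype.expect_eq_sum_div_card]
  exact (integrable_finsetSum _ fun i _ => hf i).div_const _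

theorem integral_expect {α ι : Type*} [MeasurableSpace α] [Fintype ι] {ν : Measure α}
    {f : ι → α → ℝ} (hf : ∀ i, Integrable (f i) ν) :
    ∫ a, 𝔼 i, f i a ∂ν = 𝔼 i, ∫ a, f i a ∂ν := by
  simp only [Fintype.expect_eq_sum_div_card]
  rw [integral_div, integral_finsetSum _ fun i _ => hf i]

theorem condExcessRisk_eq [MeasurableSpace X] {ρ : Measure (X × Y)} (hm : 1 ≤ m) (z : Fin m → X × Y) :
    condExcessRisk ρ V Φ g z =
      (𝔼 J, risk ρ V Φ (g z J)) - ⨅ v : F, risk ρ V Φ v := by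
  have : Nonempty (Fin m) := ⟨⟨0, hm⟩⟩
  rw [condExcessRisk, integral_indexLaw hm]
  simp only [excessRisk]
  rw [Finset.expect_sub_distrib, Fintype.expect_const]

end Output

/-! ### Expected excess risk: integrability and the three-term bound -/

section Risk

variable {X : Type*} [MeasurableSpace X] {Y : Set ℝ}
  {F : Type*} [NormedAddCommGroup F] [InnerProductSpace ℝ F] [CompleteSpace F]
  [TopologicalSpace.SeparableSpace F] [MeasurableSpace F] [BorelSpace F]
  {ρ : Measure (X × Y)} [IsProbabilityMeasure ρ]
  {V : ℝ → ℝ → ℝ} {Φ : X → F} {L κ a₀ : ℝ} {η : ℕ → ℝ} {m t : ℕ}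
  {g : (Fin m → X × Y) → (Finset.Icc 1 t → Fin m) → F}

theorem measurable_output (hV : Measurable fun p : ℝ × ℝ => V p.1 p.2) (hΦ : Measurable Φ)
    (hs : SmoothAssumption Y V L) (hg : IsOutput V Φ η t g) (J : Finset.Icc 1 t → Fin m) :
    Measurable fun z => g z J := by
  rcases hg with rfl | rfl
  · have := Finset.measurable_sum (Finset.Icc 1 t) fun k _ =>
      (measurable_iterate (η := η) hV hΦ hs J k).const_smul (η k)
    exact this.const_smul (∑ k ∈ Finset.Icc 1 t, η k)⁻¹
  · exact measurable_iterate hV hΦ hs J t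

theorem integrable_pointLoss_comp (hV : Measurable fun p : ℝ × ℝ => V p.1 p.2)
    (hV0 : ∀ y a : ℝ, 0 ≤ V y a) (hΦ : Measurable Φ) (hb : BoundedAssumption Y V Φ κ a₀)
    (hs : SmoothAssumption Y V L) {α : Type*} [MeasurableSpace α] (ν : Measure α)
    [IsFiniteMeasure ν] {a : α → X × Y} {u : α → F} (ha : Measurable a) (hu : Measurable u)
    {M : ℝ} (hM : ∀ p, ‖u p‖ ≤ M) : Integrable (fun p => pointLoss V Φ (a p) (u p)) ν := by
  obtain ⟨K, -, hK⟩ := hb.exists_abs_pointLoss_le hs hV0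
  refine Integrable.of_bound
    ((measurable_pointLoss hV hΦ).comp (ha.prodMk hu)).aestronglyMeasurable
    (K + a₀ * κ * M) (ae_of_all _ fun p => (hK _ _).trans ?_)
  have hG : 0 ≤ a₀ * κ := mul_nonneg (hb.nonneg (a p)).2 (hb.nonneg (a p)).1
  exact add_le_add le_rfl (mul_le_mul_of_nonneg_left (hM p) hG)

theorem integrable_risk_comp (hV : Measurable fun p : ℝ × ℝ => V p.1 p.2)
    (hV0 : ∀ y a : ℝ, 0 ≤ V y a) (hΦ : Measurable Φ) (hb : BoundedAssumption Y V Φ κ a₀)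
    (hs : SmoothAssumption Y V L) {α : Type*} [MeasurableSpace α] (ν : Measure α)
    [IsFiniteMeasure ν] {u : α → F} (hu : Measurable u) {M : ℝ} (hM : ∀ p, ‖u p‖ ≤ M) :
    Integrable (fun p => risk ρ V Φ (u p)) ν :=
  (integrable_pointLoss_comp hV hV0 hΦ hb hs (ν.prod ρ) measurable_snd
    (hu.comp measurable_fst) fun p => hM p.1).integral_prod_left

theorem integrable_condExcessRisk (hV : Measurable fun p : ℝ × ℝ => V p.1 p.2)
    (hV0 : ∀ y a : ℝ, 0 ≤ V y a) (hΦ : Measurable Φ) (hb : BoundedAssumption Y V Φ κ a₀)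
    (hs : SmoothAssumption Y V L) (hη : ∀ k, 0 ≤ η k) (hm : 1 ≤ m) (hg : IsOutput V Φ η t g) :
    Integrable (condExcessRisk ρ V Φ g) (sampleLaw ρ m) := by
  have : IsProbabilityMeasure (sampleLaw ρ m) := by unfold sampleLaw; infer_instance
  have : condExcessRisk ρ V Φ g = fun z => (𝔼 J, risk ρ V Φ (g z J)) - ⨅ v : F, risk ρ V Φ v :=
    funext fun z => condExcessRisk_eq hm z
  rw [this]
  exact (integrable_expect fun J => integrable_risk_comp hV hV0 hΦ hb hs _
    (measurable_output hV hΦ hs hg J) fun z => hb.norm_output_le hη hg z J).sub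
      (integrable_const _)

/-- Excess risk against an arbitrary comparator: optimization error plus generalization gap. -/
theorem meanExcessRisk_le_comparator (hV : Measurable fun p : ℝ × ℝ => V p.1 p.2)
    (hV0 : ∀ y a : ℝ, 0 ≤ V y a) (hΦ : Measurable Φ) (hb : BoundedAssumption Y V Φ κ a₀)
    (hs : SmoothAssumption Y V L) (hL : 0 < L) {η₁ : ℝ} (hη₁ : 0 < η₁)
    (hstep : η₁ * (κ ^ 2 * L) ≤ 2) (hm : 1 ≤ m) (ht : 1 ≤ t)
    (hg : IsOutput V Φ (fun k => η₁ / √(k : ℝ)) t g) (w : F) :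
    meanExcessRisk ρ V Φ g ≤ risk ρ V Φ w + (1 / (η₁ * √(t : ℝ))) / 2 * ‖w‖ ^ 2
      + 3 * ((a₀ * κ) ^ 2 / 2) * η₁ * ((1 + Real.log t) / √(t : ℝ))
      + 2 * (a₀ * κ) ^ 2 * (∑ l ∈ Finset.range t, η₁ / √(l : ℝ)) / m
      - ⨅ v : F, risk ρ V Φ v := by
  have : Nonempty (Fin m) := ⟨⟨0, hm⟩⟩
  have hη : ∀ k : ℕ, 0 ≤ η₁ / √(k : ℝ) := fun k => by positivity
  have hηstep : ∀ k : ℕ, η₁ / √(k : ℝ) * (κ ^ 2 * L) ≤ 2 := by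
    intro k
    refine le_trans (mul_le_mul_of_nonneg_right ?_ (by positivity)) hstep
    rcases Nat.eq_zero_or_pos k with rfl | hk
    · simpa using hη₁.le
    · exact div_le_self hη₁.le (Real.one_le_sqrt.2 (by exact_mod_cast hk))
  have hP : IsProbabilityMeasure (sampleLaw ρ m) := by unfold sampleLaw; infer_instance
  obtain ⟨z₀⟩ : Nonempty (X × Y) := nonempty_of_isProbabilityMeasure ρ
  have hG : 0 ≤ a₀ * κ := mul_nonneg (hb.nonneg z₀).2 (hb.nonneg z₀).1
  obtain ⟨K, hK0, -⟩ := hb.exists_abs_pointLoss_le hs hV0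
  set S := ∑ l ∈ Finset.range t, η₁ / √(l : ℝ) with hS
  set A := (1 / (η₁ * √(t : ℝ))) / 2 * ‖w‖ ^ 2
      + 3 * ((a₀ * κ) ^ 2 / 2) * η₁ * ((1 + Real.log t) / √(t : ℝ)) with hA
  have hmeas := measurable_output hV hΦ hs hg
  have hbound := fun z J => hb.norm_output_le hη hg z J
  have hIrisk : ∀ J, Integrable (fun z => risk ρ V Φ (g z J)) (sampleLaw ρ m) := fun J =>
    integrable_risk_comp hV hV0 hΦ hb hs _ (hmeas J) fun z => hbound z J
  have hIemp : ∀ u : (Fin m → X × Y) → F, Measurable u → ∀ M : ℝ, (∀ z, ‖u z‖ ≤ M) →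
      Integrable (fun z => empRisk V Φ z (u z)) (sampleLaw ρ m) := fun u hu M hM =>
    (integrable_finsetSum _ fun i _ => integrable_pointLoss_comp hV hV0 hΦ hb hs _
      (measurable_pi_apply i) hu hM).const_mul _
  have hIempg := fun J => hIemp _ (hmeas J) _ fun z => hbound z J
  have hIempw := hIemp (fun _ => w) measurable_const ‖w‖ fun _ => le_rfl
  -- For fixed `J` the output is a deterministic function of the sample, so stability applies to
  -- each `J` separately.
  have gap : ∀ J, ∫ z, risk ρ V Φ (g z J) ∂(sampleLaw ρ m) ≤
      ∫ z, empRisk V Φ z (g z J) ∂(sampleLaw ρ m) + 2 * (a₀ * κ) ^ 2 * S / m := by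
    intro J
    have := integral_risk_sub_le ρ hm (measurable_pointLoss hV hΦ) hG
      (hb.pointLoss_lipschitz hs) hK0 (hmeas J) (fun z => hbound z J)
      fun z z' => hb.sum_norm_output_update_le hs hη hηstep hg z z' J
    refine this.trans (le_of_eq ?_)
    rw [← hS]
    congr 1
    ring
  -- The comparator does not depend on the sample, so its empirical risk is unbiased.
  have hw : ∫ z, empRisk V Φ z w ∂(sampleLaw ρ m) = risk ρ V Φ w := by
    have hi : ∀ i : Fin m, ∫ z, pointLoss V Φ (z i) w ∂(sampleLaw ρ m) = risk ρ V Φ w := by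
      intro i
      have hmp := measurePreserving_eval (fun _ : Fin m => ρ) i
      have hm1 : Measurable fun x : X × Y => pointLoss V Φ x w :=
        (measurable_pointLoss hV hΦ).comp (measurable_id.prodMk measurable_const)
      have h2 := integral_map (μ := Measure.pi fun _ : Fin m => ρ) hmp.measurable.aemeasurable
        hm1.aestronglyMeasurable
      rw [hmp.map_eq] at h2
      exact h2.symm
    simp only [empRisk]
    rw [integral_const_mul, integral_finsetSum _ fun i _ => integrable_pointLoss_comp hV hV0 hΦ hb
      hs _ (measurable_pi_apply i) measurable_const fun _ => le_rfl]
    have : (m : ℝ) ≠ 0 := by positivity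
    simp only [hi, Finset.sum_const, Finset.card_univ, Fintype.card_fin, nsmul_eq_mul]
    field_simp
  have hmean : meanExcessRisk ρ V Φ g =
      (𝔼 J, ∫ z, risk ρ V Φ (g z J) ∂(sampleLaw ρ m)) - ⨅ v : F, risk ρ V Φ v := by
    simp only [meanExcessRisk, condExcessRisk_eq hm]
    rw [integral_sub (integrable_expect hIrisk) (integrable_const _), integral_expect hIrisk]
    simp
  have h1 : 𝔼 J, ∫ z, risk ρ V Φ (g z J) ∂(sampleLaw ρ m) ≤
      ∫ z, 𝔼 J, empRisk V Φ z (g z J) ∂(sampleLaw ρ m) + 2 * (a₀ * κ) ^ 2 * S / m := by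
    rw [integral_expect hIempg]
    refine (Finset.expect_le_expect fun J _ => gap J).trans (le_of_eq ?_)
    rw [Finset.expect_add_distrib, Fintype.expect_const]
  have h2 : ∫ z, 𝔼 J, empRisk V Φ z (g z J) ∂(sampleLaw ρ m) ≤ risk ρ V Φ w + A := by
    have : risk ρ V Φ w + A = ∫ z, (empRisk V Φ z w + A) ∂(sampleLaw ρ m) := by
      rw [integral_add hIempw (integrable_const _), hw]; simp
    rw [this]
    refine integral_mono (integrable_expect hIempg) (hIempw.add (integrable_const _)) fun z => ?_
    have := hb.expect_empRisk_le hs hη₁ hm ht hg z w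
    simp only [hA]
    linarith
  rw [hmean]
  linarith

theorem meanExcessRisk_le (hV : Measurable fun p : ℝ × ℝ => V p.1 p.2)
    (hV0 : ∀ y a : ℝ, 0 ≤ V y a) (hΦ : Measurable Φ) (hb : BoundedAssumption Y V Φ κ a₀)
    {β cβ : ℝ} (hβ1 : β ≤ 1) (hcβ : 0 < cβ) (ha : ApproxAssumption ρ V Φ β cβ)
    (hs : SmoothAssumption Y V L) (hL : 0 < L) {η₁ : ℝ} (hη₁ : 0 < η₁)
    (hstep : η₁ * (κ ^ 2 * L) ≤ 2) (hm : 1 ≤ m) (ht : 1 ≤ t)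
    (hg : IsOutput V Φ (fun k => η₁ / √(k : ℝ)) t g) :
    meanExcessRisk ρ V Φ g ≤ (10 * (a₀ * κ) ^ 2 * η₁ + cβ * (1 / η₁) ^ β + 1) *
      (√(t : ℝ) * Real.log t / m + Real.log t / √(t : ℝ) + 1 / (t : ℝ) ^ (β / 2)) := by
  have ht1 : (1 : ℝ) ≤ t := by exact_mod_cast ht
  have ht0 : (0 : ℝ) < t := by linarith
  have hs0 := Real.sqrt_pos.2 ht0
  have hl : 0 ≤ Real.log t := Real.log_nonneg ht1
  have hcomp := fun w => meanExcessRisk_le_comparator (ρ := ρ) hV hV0 hΦ hb hs hL hη₁ hstep hm ht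
    hg w
  have happ := ha (1 / (η₁ * √(t : ℝ))) (by positivity)
  have hpow : (1 / (η₁ * √(t : ℝ))) ^ β = (1 / η₁) ^ β * (1 / (t : ℝ) ^ (β / 2)) := by
    rw [← one_div_mul_one_div, Real.mul_rpow (by positivity) (by positivity),
      Real.div_rpow zero_le_one hs0.le, Real.one_rpow, Real.sqrt_eq_rpow,
      ← Real.rpow_mul ht0.le]
    rw [one_div_mul_eq_div 2 β]
  -- Since `β ≤ 1`, the part of the optimization error without a logarithm merges into the
  -- approximation term.
  have hsq : 1 / √(t : ℝ) ≤ 1 / (t : ℝ) ^ (β / 2) := by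
    apply one_div_le_one_div_of_le (by positivity)
    rw [Real.sqrt_eq_rpow]
    exact Real.rpow_le_rpow_of_exponent_le ht1 (by linarith)
  have hsum := sum_range_stepSize_le_log hη₁ ht
  have hgap : 2 * (a₀ * κ) ^ 2 * (∑ l ∈ Finset.range t, η₁ / √(l : ℝ)) / m ≤
      8 * (a₀ * κ) ^ 2 * η₁ * (√(t : ℝ) * Real.log t / m) := by
    have := mul_le_mul_of_nonneg_left hsum (by positivity : 0 ≤ 2 * (a₀ * κ) ^ 2)
    have := div_le_div_of_nonneg_right this (Nat.cast_nonneg (α := ℝ) m)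
    refine this.trans (le_of_eq ?_)
    ring
  -- The comparator bound holds for every `w`; its infimum is the regularized risk with `λ =
  -- 1/(η₁√t)`.
  have hinf : meanExcessRisk ρ V Φ g
      - 3 * ((a₀ * κ) ^ 2 / 2) * η₁ * ((1 + Real.log t) / √(t : ℝ))
      - 2 * (a₀ * κ) ^ 2 * (∑ l ∈ Finset.range t, η₁ / √(l : ℝ)) / m
      + ⨅ v : F, risk ρ V Φ v ≤
      ⨅ w : F, (risk ρ V Φ w + 1 / (η₁ * √(t : ℝ)) / 2 * ‖w‖ ^ 2) :=
    le_ciInf fun w => by linarith [hcomp w]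
  rw [approxError, hpow] at happ
  have hsplit : (1 + Real.log t) / √(t : ℝ) = 1 / √(t : ℝ) + Real.log t / √(t : ℝ) := add_div _ _ _
  rw [hsplit] at hinf
  have p1 : 0 ≤ √(t : ℝ) * Real.log t / m := by positivity
  have p2 : 0 ≤ Real.log t / √(t : ℝ) := by positivity
  have p3 : 0 ≤ 1 / (t : ℝ) ^ (β / 2) := by positivity
  set P1 := √(t : ℝ) * Real.log t / m
  set P2 := Real.log t / √(t : ℝ)
  set P3 := 1 / (t : ℝ) ^ (β / 2)
  have c1 : 0 ≤ (a₀ * κ) ^ 2 * η₁ := by positivity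
  have c2 : 0 ≤ cβ * (1 / η₁) ^ β := by positivity
  set Q := (a₀ * κ) ^ 2 * η₁ with hQ
  set R := cβ * (1 / η₁) ^ β with hR
  have e1 : 3 * ((a₀ * κ) ^ 2 / 2) * η₁ * (1 / √(t : ℝ) + P2) =
    3 / 2 * Q * (1 / √(t : ℝ)) + 3 / 2 * Q * P2 := by rw [hQ]; ring
  have e2 : 8 * (a₀ * κ) ^ 2 * η₁ * P1 = 8 * (Q * P1) := by rw [hQ]; ring
  have e3 : cβ * ((1 / η₁) ^ β * P3) = R * P3 := by rw [hR]; ring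
  have e4 : 10 * (a₀ * κ) ^ 2 * η₁ = 10 * Q := by rw [hQ]; ring
  rw [e1] at hinf
  rw [e2] at hgap
  rw [e3] at happ
  rw [e4]
  have h5 := mul_le_mul_of_nonneg_left hsq (by positivity : 0 ≤ 3 / 2 * Q)
  have := mul_nonneg c1 p1
  have := mul_nonneg c1 p2
  have := mul_nonneg c1 p3
  have := mul_nonneg c2 p1
  have := mul_nonneg c2 p2
  nlinarith

end Risk

/-! ### Balancing at the stopping time -/

section StoppingTime

/-- At `s = m^{2/(β+1)}` both `√s / m` and `s^{-β/2}` equal `m^{-β/(β+1)}`, and `1/√s` is no larger.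
Rounding up at most doubles `s`. The three terms contribute `6 + 3 + 2 = 11`. -/
theorem bound_at_stoppingTime {β : ℝ} (hβ0 : 0 < β) (hβ1 : β ≤ 1) {m t : ℕ} (hm : 2 ≤ m)
    (ht : t = ⌈(m : ℝ) ^ (2 / (β + 1))⌉₊) :
    1 ≤ t ∧ √(t : ℝ) * Real.log t / m + Real.log t / √(t : ℝ) + 1 / (t : ℝ) ^ (β / 2) ≤
      11 * ((m : ℝ) ^ (-(β / (β + 1))) * Real.log m) := by
  have hm2 : (2 : ℝ) ≤ m := by exact_mod_cast hm
  have hm1 : (1 : ℝ) ≤ m := by linarith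
  have hm0 : (0 : ℝ) < m := by linarith
  have hβ : 0 < β + 1 := by linarith
  set s : ℝ := (m : ℝ) ^ (2 / (β + 1)) with hs
  have hs1 : 1 ≤ s := Real.one_le_rpow hm1 (by positivity)
  have hs0 : 0 < s := by linarith
  have hst : s ≤ t := ht ▸ Nat.le_ceil s
  have hts : (t : ℝ) ≤ 2 * s := by
    have := Nat.ceil_lt_add_one hs0.le
    rw [← ht] at this
    linarith
  have ht1 : (1 : ℝ) ≤ t := hs1.trans hst
  have ht0 : (0 : ℝ) < t := by linarith
  refine ⟨by exact_mod_cast ht1, ?_⟩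
  have hsm : s ≤ (m : ℝ) ^ 2 := by
    rw [← Real.rpow_natCast]
    refine Real.rpow_le_rpow_of_exponent_le hm1 ?_
    rw [div_le_iff₀ hβ]; push_cast; linarith
  have hlm : 0 ≤ Real.log m := Real.log_nonneg hm1
  have hlt : 0 ≤ Real.log t := Real.log_nonneg ht1
  -- `t ≤ 2s ≤ 2m² ≤ m³`, the last step because `m ≥ 2`.
  have hlog : Real.log t ≤ 3 * Real.log m := by
    have h1 : (t : ℝ) ≤ (m : ℝ) ^ 3 := by nlinarith [sq_nonneg (m : ℝ)]
    have h2 := Real.log_le_log ht0 h1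
    rw [Real.log_pow] at h2
    exact_mod_cast h2
  have hsqrt_s : √s = (m : ℝ) ^ (1 / (β + 1)) := by
    rw [Real.sqrt_eq_rpow, hs, ← Real.rpow_mul hm0.le]
    congr 1; field_simp
  set q : ℝ := (m : ℝ) ^ (-(β / (β + 1))) with hq
  have hq0 : 0 < q := Real.rpow_pos_of_pos hm0 _
  have hqs : √s / m = q := by
    rw [hsqrt_s, hq, ← Real.rpow_sub_one hm0.ne']
    congr 1; field_simp; ring
  have hsq0 : 0 < √s := Real.sqrt_pos.2 hs0
  have hsqt : √(t : ℝ) ≤ 2 * √s := by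
    rw [Real.sqrt_le_left (by positivity), mul_pow, Real.sq_sqrt hs0.le]
    linarith
  have hsqt' : √s ≤ √(t : ℝ) := Real.sqrt_le_sqrt hst
  have t1 : √(t : ℝ) * Real.log t / m ≤ 6 * (q * Real.log m) := by
    calc √(t : ℝ) * Real.log t / m ≤ (2 * √s) * (3 * Real.log m) / m := by gcongr
      _ = 6 * (√s / m * Real.log m) := by ring
      _ = _ := by rw [hqs]
  have hinv : 1 / √s ≤ q := by
    rw [hsqrt_s, hq, one_div, ← Real.rpow_neg hm0.le]
    refine Real.rpow_le_rpow_of_exponent_le hm1 ?_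
    gcongr
  have t2 : Real.log t / √(t : ℝ) ≤ 3 * (q * Real.log m) := by
    calc Real.log t / √(t : ℝ) ≤ 3 * Real.log m / √s := by gcongr
      _ = 3 * Real.log m * (1 / √s) := by ring
      _ ≤ 3 * Real.log m * q := by gcongr
      _ = _ := by ring
  have t3 : 1 / (t : ℝ) ^ (β / 2) ≤ 2 * (q * Real.log m) := by
    have h1 : 1 / (t : ℝ) ^ (β / 2) ≤ 1 / s ^ (β / 2) := by gcongr
    have h2 : 1 / s ^ (β / 2) = q := by
      rw [hs, hq, ← Real.rpow_mul hm0.le, one_div, ← Real.rpow_neg hm0.le]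
      congr 1; field_simp
    -- This term carries no logarithm; `m ≥ 2` supplies one at the cost of a factor 2.
    have h3 : 1 / 2 ≤ Real.log m := by
      have := Real.log_le_log (by norm_num) hm2
      linarith [Real.log_two_gt_d9]
    rw [h2] at h1
    nlinarith
  linarith

end StoppingTime

end SGM

theorem corollary2 (κ a₀ β cβ η₁ : ℝ) (hβ0 : 0 < β) (hβ1 : β ≤ 1) (hcβ : 0 < cβ) (hη₁ : 0 < η₁) :
    -- the constant depends only on `κ, a₀, β, cβ, η₁`
    ∃ C : ℝ, 0 < C ∧
      ∀ (X : Type*) [MeasurableSpace X] (F : Type*) [NormedAddCommGroup F] [InnerProductSpace ℝ F]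
        [CompleteSpace F] [TopologicalSpace.SeparableSpace F] [MeasurableSpace F] [BorelSpace F]
        (Y : Set ℝ) (ρ : MeasureTheory.Measure (X × Y)) [MeasureTheory.IsProbabilityMeasure ρ]
        (V : ℝ → ℝ → ℝ) (Φ : X → F) (L : ℝ),
        Measurable (fun p : ℝ × ℝ => V p.1 p.2) → (∀ y a : ℝ, 0 ≤ V y a) → Measurable Φ →
        SGM.BoundedAssumption Y V Φ κ a₀ →
        SGM.ApproxAssumption ρ V Φ β cβ →
        0 < L → SGM.SmoothAssumption Y V L →
        -- this is `η₁ ≤ 2 / (κ² L)`, with no constraint if `κ = 0`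
        η₁ * (κ ^ 2 * L) ≤ 2 →
        ∀ m : ℕ, 1 ≤ m →
          (∀ t : ℕ, 1 ≤ t →
            ∀ g : (Fin m → X × Y) → (Finset.Icc 1 t → Fin m) → F,
              SGM.IsOutput V Φ (fun k => η₁ / √(k : ℝ)) t g →
              MeasureTheory.Integrable (SGM.condExcessRisk ρ V Φ g) (SGM.sampleLaw ρ m) ∧
              SGM.meanExcessRisk ρ V Φ g ≤
                C * (√(t : ℝ) * Real.log t / m + Real.log t / √(t : ℝ)
                  + 1 / (t : ℝ) ^ (β / 2))) ∧
          (2 ≤ m → ∀ t : ℕ, t = ⌈(m : ℝ) ^ (2 / (β + 1))⌉₊ →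
            ∀ g : (Fin m → X × Y) → (Finset.Icc 1 t → Fin m) → F,
              SGM.IsOutput V Φ (fun k => η₁ / √(k : ℝ)) t g →
              SGM.meanExcessRisk ρ V Φ g ≤ C * ((m : ℝ) ^ (-(β / (β + 1))) * Real.log m)) := by
  have hc : 0 < 10 * (a₀ * κ) ^ 2 * η₁ + cβ * (1 / η₁) ^ β + 1 := by positivity
  -- The factor 11 comes from the stopping time; it lets one constant serve both bounds.
  refine ⟨11 * (10 * (a₀ * κ) ^ 2 * η₁ + cβ * (1 / η₁) ^ β + 1), by positivity, ?_⟩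
  intro X _ F _ _ _ _ _ _ Y ρ _ V Φ L hV hV0 hΦ hb ha hL hs hstep m hm
  refine ⟨fun t ht g hg => ⟨?_, ?_⟩, fun hm2 t ht g hg => ?_⟩
  · exact SGM.integrable_condExcessRisk hV hV0 hΦ hb hs (fun k => by positivity) hm hg
  · refine (SGM.meanExcessRisk_le hV hV0 hΦ hb hβ1 hcβ ha hs hL hη₁ hstep hm ht hg).trans ?_
    have hl : 0 ≤ Real.log t := Real.log_nonneg (by exact_mod_cast ht)
    refine mul_le_mul_of_nonneg_right (by linarith) (by positivity)
  · obtain ⟨ht1, hbound⟩ := SGM.bound_at_stoppingTime hβ0 hβ1 hm2 ht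
    refine (SGM.meanExcessRisk_le hV hV0 hΦ hb hβ1 hcβ ha hs hL hη₁ hstep hm ht1 hg).trans ?_
    refine (mul_le_mul_of_nonneg_left hbound hc.le).trans (le_of_eq ?_)
    ring
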